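/- Let $(X,d)$ be a metric space, let $\phi:X\to(-\infty,+\infty]$ be lower semicontinuous with nonempty domain $\mathrm{Dom}\,\phi=\{\phi<+\infty\}$, let $\lambda\in\mathbb R$ and $D\subset\overline{\mathrm{Dom}\,\phi}$. *Definitions.* An $\mathrm{EVI}_\lambda$-gradient flow of $\phi$ in $D$ is a family of continuous maps $S_t:D\to D$, $t\ge 0$, such that for every $u_0\in D$ one has $S_{t+h}(u_0)=S_h(S_t(u_0))$ for all $t,h\ge 0$, $\lim_{t\downarrow 0}S_t(u_0)=S_0(u_0)=u_0$, and $u_t=S_t(u_0)$, $t>0$, is a continuous curve with values in $\mathrm{Dom}\,\phi$ such that $$\frac12\frac{d^+}{dt}d^2(u_t,v)+\frac\lambda2 d^2(u_t,v)\le\phi(v)-\phi(u_t)\qquad\text{for all }t>0,\ v\in\mathrm{Dom}\,\phi,$$ where $\frac{d^+}{dt}$ is the upper right Dini derivative. Put $E_\lambda(t)=\int_0^t e^{\lambda r}\,dr$. For $\vartheta,\varepsilon\in(0,1)$, a point $x$ is a $(\vartheta,\varepsilon)$-intermediate point between $x_0$ and $x_1$ if $$\frac{d^2(x_0,x)}{\vartheta}+\frac{d^2(x,x_1)}{1-\vartheta}\le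 d^2(x_0,x_1)\bigl(1+\varepsilon^2\vartheta(1-\vartheta)\bigr).$$ A set $D$ is an approximate length subset if for all $x_0,x_1\in D$ and $\varepsilon\in(0,1)$ there is a $(\tfrac12,\varepsilon)$-intermediate point between $x_0$ and $x_1$ in $D$. The functional $\phi$ is approximately $\lambda$-convex in $D$ if for all $x_0,x_1\in D\cap\mathrm{Dom}\,\phi$ and $\vartheta,\varepsilon\in(0,1)$ there is a $(\vartheta,\varepsilon)$-intermediate point $x\in D$ between $x_0$ and $x_1$ with $$\phi(x)\le(1-\vartheta)\phi(x_0)+\vartheta\phi(x_1)-\frac{\lambda-\varepsilon}2\vartheta(1-\vartheta)d^2(x_0,x_1).$$ A geodesic in $D$ from $x_0$ to $x_1$ is a curve $\gamma:[0,1]\to D$ with $\gamma_0=x_0$, $\gamma_1=x_1$ and $d(\gamma_s,\gamma_t)=|s-t|\,d(x_0,x_1)$ for all $s,t\in[0,1]$. The functional $\phi$ is strongly $\lambda$-convex in $D$ if for all $x_0,x_1\in D\cap\mathrm{Dom}\,\phi$ there is a geodesic in $D$ from $x_0$ to $x_1$, and every such geodesic $\gamma$ satisfies $$\phi(\gamma_t)\le(1-t)\phi(x_0)+t\phi(x_1)-\frac\lambda2t(1-t)d^2(x_0,x_1)\quad\text{for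 all }t\in[0,1].\tag{$*$}$$ A curve $x:[0,1]\to X$ is absolutely continuous if there is $m\in L^1(0,1)$ with $d(x_s,x_t)\le\int_s^t m(r)\,dr$ for all $0\le s\le t\le 1$. The length distance $d_\ell(x_0,x_1)\in[0,+\infty]$ is the infimum of the lengths $\int_0^1|\dot x|(t)\,dt$, where $|\dot x|(t)=\lim_{h\to0}d(x_{t+h},x_t)/|h|$ is the metric derivative, over the absolutely continuous curves in $X$ from $x_0$ to $x_1$ ($+\infty$ if there are none). Write $x\sim_\ell y$ if $d_\ell(x,y)<\infty$. **Theorem.** Suppose that $\phi$ admits an $\mathrm{EVI}_\lambda$-gradient flow $(S_t)_{t\ge0}$ in $D$. Then: 1. If $x_0,x_1\in D\cap\mathrm{Dom}\,\phi$, $\vartheta,\varepsilon\in(0,1)$, and $x_{\vartheta,\varepsilon}\in D$ is a $(\vartheta,\varepsilon)$-intermediate point between $x_0$ and $x_1$, then for every $t>0$ $$\phi(S_t(x_{\vartheta,\varepsilon}))\le(1-\vartheta)\phi(x_0)+\vartheta\phi(x_1)-\frac12\Bigl(\lambda-\frac{\varepsilon^2}{E_\lambda(t)}\Bigr)\vartheta(1-\vartheta)\,d^2(x_0,x_1).$$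 2. If $D$ is an approximate length subset, then $\phi$ is approximately $\lambda$-convex in $D$. 3. If $D=X$ and $X$ is the closure of $\mathrm{Dom}\,\phi$ with respect to $d_\ell$, then $\phi$ is approximately $\lambda$-convex with respect to the distance $d_\ell$ (in place of $d$) on each equivalence class of $\sim_\ell$. 4. If $x_0,x_1\in D\cap\mathrm{Dom}\,\phi$, then every geodesic in $D$ from $x_0$ to $x_1$ satisfies $(*)$. In particular, if any two points of $D\cap\mathrm{Dom}\,\phi$ are connected by a geodesic in $D$, then $\phi$ is strongly $\lambda$-convex in $D$. -/

import Mathlib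

open Set Filter Topology MeasureTheory

noncomputable section

namespace EVI

variable {X : Type*}

/-- The domain of a functional `φ` with values in `(-∞, +∞]`. -/
def dom (φ : X → EReal) : Set X := {x | φ x < ⊤}

/-- `x` is a `(θ, ε)`-intermediate point between `x₀` and `x₁` for the distance function `d`. -/
def IsIntermediatePoint (d : X → X → ℝ) (θ ε : ℝ) (x₀ x₁ x : X) : Prop :=
  d x₀ x ^ 2 / θ + d x x₁ ^ 2 / (1 - θ) ≤ d x₀ x₁ ^ 2 * (1 + ε ^ 2 * θ * (1 - θ))

/-- Approximate `lam`-convexity of `φ` in `D`, for the (finite on `D`) distance function `d`. -/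
def ApproxConvexIn (d : X → X → ℝ) (φ : X → EReal) (lam : ℝ) (D : Set X) : Prop :=
  ∀ x₀ ∈ D ∩ dom φ, ∀ x₁ ∈ D ∩ dom φ, ∀ θ ∈ Ioo (0 : ℝ) 1, ∀ ε ∈ Ioo (0 : ℝ) 1,
    ∃ x ∈ D, IsIntermediatePoint d θ ε x₀ x₁ x ∧
      φ x ≤ ((1 - θ : ℝ) : EReal) * φ x₀ + (θ : EReal) * φ x₁
        - (((lam - ε) / 2 * θ * (1 - θ) * d x₀ x₁ ^ 2 : ℝ) : EReal)

/-- The primitive `∫₀ᵗ exp (lam r) dr` of the exponential. -/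
def expPrimitive (lam t : ℝ) : ℝ := ∫ r in (0 : ℝ)..t, Real.exp (lam * r)

/-- The upper right Dini derivative, with values in `[-∞, +∞]`. -/
def upperRightDini (ζ : ℝ → ℝ) (t : ℝ) : EReal :=
  limsup (fun h : ℝ => (((ζ (t + h) - ζ t) / h : ℝ) : EReal)) (𝓝[>] 0)

variable [MetricSpace X]

/-- `D` contains an `ε`-midpoint of any two of its points, for every `ε ∈ (0, 1)`. -/
def IsApproxLength (D : Set X) : Prop :=
  ∀ x₀ ∈ D, ∀ x₁ ∈ D, ∀ ε ∈ Ioo (0 : ℝ) 1, ∃ x ∈ D, IsIntermediatePoint dist (1 / 2) ε x₀ x₁ x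

/-- The restriction of `γ` to `[0, 1]` is a (constant speed, minimal) geodesic with values in `D`
that connects `x₀` to `x₁`. The values of `γ` outside `[0, 1]` are irrelevant. -/
structure IsGeodesicIn (D : Set X) (x₀ x₁ : X) (γ : ℝ → X) : Prop where
  mem : ∀ t ∈ Icc (0 : ℝ) 1, γ t ∈ D
  start : γ 0 = x₀
  finish : γ 1 = x₁
  dist_eq : ∀ s ∈ Icc (0 : ℝ) 1, ∀ t ∈ Icc (0 : ℝ) 1, s < t →
    dist (γ s) (γ t) = (t - s) * dist (γ 0) (γ 1)

/-- The `lam`-convexity inequality of `φ` along the curve `γ` on `[0, 1]`. -/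
def ConvexAlong (φ : X → EReal) (lam : ℝ) (γ : ℝ → X) : Prop :=
  ∀ t ∈ Icc (0 : ℝ) 1,
    φ (γ t) ≤ ((1 - t : ℝ) : EReal) * φ (γ 0) + (t : EReal) * φ (γ 1)
      - ((lam / 2 * t * (1 - t) * dist (γ 0) (γ 1) ^ 2 : ℝ) : EReal)

/-- `lam`-convexity in `D`: some geodesic of `D` between any two points of `D ∩ dom φ`
satisfies the convexity inequality. -/
def ConvexIn (φ : X → EReal) (lam : ℝ) (D : Set X) : Prop :=
  ∀ x₀ ∈ D ∩ dom φ, ∀ x₁ ∈ D ∩ dom φ, ∃ γ, IsGeodesicIn D x₀ x₁ γ ∧ ConvexAlong φ lam γ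

/-- Strong `lam`-convexity in `D`: moreover every such geodesic satisfies the inequality. -/
def StronglyConvexIn (φ : X → EReal) (lam : ℝ) (D : Set X) : Prop :=
  ConvexIn φ lam D ∧
    ∀ x₀ ∈ D ∩ dom φ, ∀ x₁ ∈ D ∩ dom φ, ∀ γ, IsGeodesicIn D x₀ x₁ γ → ConvexAlong φ lam γ

/-- The restriction of `x` to `[0, 1]` is an absolutely continuous curve with values in `D`. -/
def IsACIn (D : Set X) (x : ℝ → X) : Prop :=
  (∀ t ∈ Icc (0 : ℝ) 1, x t ∈ D) ∧
    ∃ m : ℝ → ℝ, IntegrableOn m (Icc 0 1) ∧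
      ∀ s ∈ Icc (0 : ℝ) 1, ∀ t ∈ Icc (0 : ℝ) 1, s ≤ t → dist (x s) (x t) ≤ ∫ r in s..t, m r

open scoped ENNReal in
/-- The metric derivative. The upper limit is the limit wherever the limit exists, that is at
almost every point for an absolutely continuous curve. -/
def metricDeriv (x : ℝ → X) (t : ℝ) : ℝ≥0∞ :=
  limsup (fun h : ℝ => ENNReal.ofReal (dist (x (t + h)) (x t) / |h|)) (𝓝[≠] 0)

open scoped ENNReal in
/-- The length of an absolutely continuous curve on `[0, 1]`. -/
def curveLength (x : ℝ → X) : ℝ≥0∞ := ∫⁻ t in Ioo (0 : ℝ) 1, metricDeriv x t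

open scoped ENNReal in
/-- The extended length distance induced in `D`; it is `∞` if no absolutely continuous curve in
`D` connects the two points. -/
def lengthDist (D : Set X) (x₀ x₁ : X) : ℝ≥0∞ :=
  ⨅ (x : ℝ → X) (_ : IsACIn D x ∧ x 0 = x₀ ∧ x 1 = x₁), curveLength x

/-- The class of `a ∈ D` modulo finiteness of the length distance of `D`. -/
def lengthClass (D : Set X) (a : X) : Set X := {x ∈ D | lengthDist D x a < ⊤}

/-- The closure of `A` with respect to the length distance of the whole space. -/
def lengthClosure (A : Set X) : Set X :=
  {x | ∀ δ : ENNReal, 0 < δ → ∃ y ∈ A, lengthDist univ x y < δ}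

/-- The restriction of `u` to `(0, ∞)` is a solution of the Evolution Variational Inequality. -/
structure IsSolution (φ : X → EReal) (lam : ℝ) (u : ℝ → X) : Prop where
  continuousOn : ContinuousOn u (Ioi 0)
  mem_dom : ∀ t, 0 < t → u t ∈ dom φ
  evi : ∀ t, 0 < t → ∀ v ∈ dom φ,
    ((1 / 2 : ℝ) : EReal) * upperRightDini (fun s => dist (u s) v ^ 2) t
      + ((lam / 2 * dist (u t) v ^ 2 : ℝ) : EReal) ≤ φ v - φ (u t)

/-- `S t`, `t ≥ 0`, restricted to `D`, is a gradient flow of `φ` in `D` in the sense of the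
Evolution Variational Inequality. The values of `S` at negative times or outside `D` are
irrelevant. -/
structure IsGradientFlow (φ : X → EReal) (lam : ℝ) (D : Set X) (S : ℝ → X → X) : Prop where
  subset : D ⊆ closure (dom φ)
  mapsTo : ∀ t, 0 ≤ t → MapsTo (S t) D D
  continuousOn : ∀ t, 0 ≤ t → ContinuousOn (S t) D
  semigroup : ∀ u ∈ D, ∀ t h, 0 ≤ t → 0 ≤ h → S (t + h) u = S h (S t u)
  zero : ∀ u ∈ D, S 0 u = u
  tendsto : ∀ u ∈ D, Tendsto (fun t => S t u) (𝓝[>] 0) (𝓝 u)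
  solution : ∀ u ∈ D, IsSolution φ lam (fun t => S t u)

end EVI

end

namespace EVI

/-! ### The primitive of the exponential -/

/-! Everything rests on an integrated form of the evolution inequality. The energy decreases along
the flow, so a Gronwall argument gives `e^{λt} d²(S_t p, v) ≤ d²(p, v) + 2 E_λ(t) (φ(v) - φ(S_t p))`
(`IsGradientFlow.exp_mul_sq_dist_le`). Let `x` be an intermediate point, and add the cases `p = x`,
`v = x₀` and `p = x`, `v = x₁` with weights `1 - θ` and `θ`. By the triangle inequality the left
side is at least `e^{λt} θ(1-θ) d²(x₀, x₁)`; by the choice of `x` the distances on the right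
contribute at most `θ(1-θ) d²(x₀, x₁)`, up to an error in `ε²`. What remains is a bound on `φ(S_t
x)`, in which `e^{λt} - 1 = λ E_λ(t)` produces the modulus `λ` (`convex_combination_estimate`,
`IsGradientFlow.le_at_intermediatePoint`). On a geodesic one may take `ε = 0`, then let `t ↓ 0` and
use lower semicontinuity.

For approximate convexity the competitor is `S_t x` itself. It must still be intermediate: `t` is
fixed small first, then `x` is chosen with a much smaller `ε'`, and a quadratic lower bound on `φ`
controls the energy term. This is `approxConvexIn_of_regularizing`, which only needs an estimate
`ρ²(v, S_t p) ≤ A ρ²(v, p) + 2B (φ(v) - φ(S_t p))` with `B → 0` and `(1 - A)/B → λ`. For `ρ = d`,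
repeated bisection turns midpoints into intermediate points for every `θ`.

For the length distance, `A = (1 + e^{-2λt})/2` and `B = t` (`IsGradientFlow.sq_lengthDist_le`). A
nearly shortest curve `γ` from `v` to `p` is moved to `s ↦ S_{st}(γ_s)`, which ends at `S_t p`. The
contraction `d(S_t x, S_t y) ≤ e^{-λt} d(x, y)` and the integrated inequality bound its small
increments, and the energy differences telescope. Curves are handled through Lipschitz constants,
whose infimum is the length distance (`lengthDist_lt_ofReal_iff`). -/

theorem hasDerivAt_expPrimitive (lam t : ℝ) :
    HasDerivAt (expPrimitive lam) (Real.exp (lam * t)) t := by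
  have hc : Continuous fun r : ℝ => Real.exp (lam * r) := by fun_prop
  exact intervalIntegral.integral_hasDerivAt_right (hc.intervalIntegrable _ _)
    (hc.stronglyMeasurableAtFilter _ _) hc.continuousAt

theorem continuous_expPrimitive (lam : ℝ) : Continuous (expPrimitive lam) :=
  continuous_iff_continuousAt.2 fun t => (hasDerivAt_expPrimitive lam t).continuousAt

@[simp] theorem expPrimitive_zero (lam : ℝ) : expPrimitive lam 0 = 0 := by
  simp [expPrimitive]

theorem mul_expPrimitive (lam t : ℝ) : lam * expPrimitive lam t = Real.exp (lam * t) - 1 := by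
  have hc : Continuous fun r : ℝ => lam * Real.exp (lam * r) := by fun_prop
  have h : ∀ x ∈ uIcc 0 t,
      HasDerivAt (fun r => Real.exp (lam * r)) (lam * Real.exp (lam * x)) x := by
    intro x _
    simpa [mul_comm] using ((hasDerivAt_id x).const_mul lam).exp
  rw [expPrimitive, ← intervalIntegral.integral_const_mul,
    intervalIntegral.integral_eq_sub_of_hasDerivAt h (hc.intervalIntegrable _ _)]
  simp

theorem expPrimitive_le (lam : ℝ) {t : ℝ} (ht : 0 ≤ t) :
    expPrimitive lam t ≤ t * Real.exp (|lam| * t) := by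
  have hc : Continuous fun r : ℝ => Real.exp (lam * r) := by fun_prop
  have h := intervalIntegral.integral_mono_on (μ := volume) ht (hc.intervalIntegrable 0 t)
    (intervalIntegrable_const (c := Real.exp (|lam| * t))) (fun x hx => by
      apply Real.exp_le_exp.2
      calc lam * x ≤ |lam| * x := mul_le_mul_of_nonneg_right (le_abs_self _) hx.1
        _ ≤ |lam| * t := mul_le_mul_of_nonneg_left hx.2 (abs_nonneg _))
  simpa [expPrimitive] using h

theorem le_expPrimitive (lam : ℝ) {t : ℝ} (ht : 0 ≤ t) :
    t * Real.exp (-(|lam| * t)) ≤ expPrimitive lam t := by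
  have hc : Continuous fun r : ℝ => Real.exp (lam * r) := by fun_prop
  have h := intervalIntegral.integral_mono_on (μ := volume) ht
    (intervalIntegrable_const (c := Real.exp (-(|lam| * t)))) (hc.intervalIntegrable 0 t)
    (fun x hx => by
      apply Real.exp_le_exp.2
      have h1 : -lam * x ≤ |lam| * x := mul_le_mul_of_nonneg_right (neg_le_abs _) hx.1
      have h2 : |lam| * x ≤ |lam| * t := mul_le_mul_of_nonneg_left hx.2 (abs_nonneg _)
      linarith)
  simpa [expPrimitive] using h

theorem expPrimitive_pos (lam : ℝ) {t : ℝ} (ht : 0 < t) : 0 < expPrimitive lam t :=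
  lt_of_lt_of_le (by positivity) (le_expPrimitive lam ht.le)

theorem expPrimitive_nonneg (lam : ℝ) {t : ℝ} (ht : 0 ≤ t) : 0 ≤ expPrimitive lam t :=
  le_trans (by positivity) (le_expPrimitive lam ht)

variable {X : Type*}

theorem coe_toReal_of_mem_dom {φ : X → EReal} (hbot : ∀ x, φ x ≠ ⊥) {x : X} (hx : x ∈ dom φ) :
    ((φ x).toReal : EReal) = φ x :=
  EReal.coe_toReal (ne_of_lt hx) (hbot x)

variable [MetricSpace X] {φ : X → EReal} {lam : ℝ}

/-! ### Solutions of the Evolution Variational Inequality -/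

/-- This is the evolution inequality in real-valued form, shaped for the one-sided comparison
theorem. Finiteness of `φ` at both points excludes the Dini derivative `+∞`. -/
theorem IsSolution.frequently_slope_lt (hbot : ∀ x, φ x ≠ ⊥) {u : ℝ → X}
    (h : IsSolution φ lam u) {t : ℝ} (ht : 0 < t) {v : X} (hv : v ∈ dom φ) {r : ℝ}
    (hr : 2 * ((φ v).toReal - (φ (u t)).toReal) - lam * dist (u t) v ^ 2 < r) :
    ∃ᶠ z in 𝓝[>] t, slope (fun s => dist (u s) v ^ 2) t z < r := by
  have hE := h.evi t ht v hv
  rw [← coe_toReal_of_mem_dom hbot hv, ← coe_toReal_of_mem_dom hbot (h.mem_dom t ht)] at hE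
  have hD : upperRightDini (fun s => dist (u s) v ^ 2) t < (r : EReal) := by
    generalize upperRightDini (fun s => dist (u s) v ^ 2) t = D at hE ⊢
    induction D with
    | bot => exact EReal.bot_lt_coe r
    | top =>
      rw [EReal.coe_mul_top_of_pos (by norm_num), EReal.top_add_coe, ← EReal.coe_sub] at hE
      exact absurd hE (not_le.2 (EReal.coe_lt_top _))
    | coe x =>
      norm_cast at hE ⊢
      linarith
  have hev := eventually_lt_of_limsup_lt hD
  have hT : Tendsto (fun z : ℝ => z - t) (𝓝[>] t) (𝓝[>] 0) := by
    refine tendsto_nhdsWithin_iff.2 ⟨?_, ?_⟩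
    · have : Tendsto (fun z : ℝ => z - t) (𝓝 t) (𝓝 (t - t)) :=
        (continuous_id.sub continuous_const).tendsto t
      rw [sub_self] at this
      exact this.mono_left nhdsWithin_le_nhds
    · filter_upwards [self_mem_nhdsWithin] with z hz
      exact sub_pos.2 (mem_Ioi.1 hz)
  refine Eventually.frequently ?_
  filter_upwards [hT.eventually hev] with z hz
  rw [EReal.coe_lt_coe_iff, add_sub_cancel] at hz
  rwa [slope_def_field]

/-- Gronwall comparison on `[s, t]`. Only an upper bound `K` on the energy gap is assumed, because
monotonicity of the energy is itself deduced from this lemma. -/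
theorem IsSolution.sq_dist_le (hbot : ∀ x, φ x ≠ ⊥) {u : ℝ → X} (h : IsSolution φ lam u)
    {s t : ℝ} (hs : 0 < s) (hst : s ≤ t) {v : X} (hv : v ∈ dom φ) {K : ℝ}
    (hK : ∀ r ∈ Ico s t, 2 * ((φ v).toReal - (φ (u r)).toReal) ≤ K) :
    Real.exp (lam * (t - s)) * dist (u t) v ^ 2
      ≤ dist (u s) v ^ 2 + K * expPrimitive lam (t - s) := by
  have hE : 0 ≤ expPrimitive lam (t - s) := expPrimitive_nonneg lam (sub_nonneg.2 hst)
  -- The slack `η` supplies the strict inequality of derivatives that the comparison theorem demands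
  -- at contact points.
  suffices H : ∀ η > 0, Real.exp (lam * (t - s)) * dist (u t) v ^ 2
      ≤ dist (u s) v ^ 2 + (K + η) * expPrimitive lam (t - s) by
    have hT : Tendsto (fun η : ℝ => dist (u s) v ^ 2 + (K + η) * expPrimitive lam (t - s))
        (𝓝[>] 0) (𝓝 (dist (u s) v ^ 2 + (K + 0) * expPrimitive lam (t - s))) := by
      apply Tendsto.mono_left _ nhdsWithin_le_nhds
      exact Continuous.tendsto (by fun_prop) 0
    rw [add_zero] at hT
    refine ge_of_tendsto hT ?_
    filter_upwards [self_mem_nhdsWithin] with η hη using H η hη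
  intro η hη
  -- `B` solves `B' = -λB + K + η` with `B s = d²(u s, v)`.
  set B : ℝ → ℝ := fun x => Real.exp (-(lam * (x - s))) *
    (dist (u s) v ^ 2 + (K + η) * expPrimitive lam (x - s)) with hBdef
  have hB : ∀ x, HasDerivAt B (-lam * B x + (K + η)) x := by
    intro x
    have h1 : HasDerivAt (fun x : ℝ => x - s) 1 x := (hasDerivAt_id x).sub_const s
    have h2 := ((h1.const_mul lam).neg).exp
    have h3 : HasDerivAt (fun x => expPrimitive lam (x - s))
        (Real.exp (lam * (x - s)) * 1) x :=
      HasDerivAt.comp x (h₂ := expPrimitive lam) (hasDerivAt_expPrimitive lam (x - s)) h1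
    have h4 := h2.mul ((h3.const_mul (K + η)).const_add (dist (u s) v ^ 2))
    convert! h4 using 1
    simp only [hBdef, Pi.neg_apply]
    have : Real.exp (-(lam * (x - s))) * Real.exp (lam * (x - s)) = 1 := by
      rw [← Real.exp_add]; simp
    linear_combination (-(K + η)) * this
  have hmain := image_le_of_liminf_slope_right_lt_deriv_boundary
    (f := fun s => dist (u s) v ^ 2)
    (f' := fun x => 2 * ((φ v).toReal - (φ (u x)).toReal) - lam * dist (u x) v ^ 2)
    (a := s) (b := t) (B := B) (B' := fun x => -lam * B x + (K + η)) ?_ ?_ ?_ hB ?_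
    (right_mem_Icc.2 hst)
  · simp only [hBdef] at hmain
    have h5 := mul_le_mul_of_nonneg_left hmain (Real.exp_pos (lam * (t - s))).le
    rwa [← mul_assoc, ← Real.exp_add, add_neg_cancel, Real.exp_zero, one_mul] at h5
  · have : ContinuousOn u (Icc s t) :=
      h.continuousOn.mono fun x hx => lt_of_lt_of_le hs hx.1
    fun_prop
  · intro x hx r hr
    exact h.frequently_slope_lt hbot (lt_of_lt_of_le hs hx.1) hv hr
  · simp [hBdef]
  · intro x hx hxB
    have := hK x hx
    rw [← hxB]
    linarith

/-- If the energy were larger at `t₁` than at `t₀`, take the last time `a` in between with energy at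
most `φ (u t₀)`. After `a` the energy exceeds `φ (u a)`, so testing with `v = u a` and `K = 0`
forces `u t₁ = u a`, a contradiction. -/
theorem IsSolution.antitoneOn (hbot : ∀ x, φ x ≠ ⊥) (hlsc : LowerSemicontinuous φ) {u : ℝ → X}
    (h : IsSolution φ lam u) : AntitoneOn (fun t => (φ (u t)).toReal) (Ioi 0) := by
  intro t₀ ht₀ t₁ ht₁ h01
  by_contra! hlt
  -- Closed sublevels make this set of times compact, so the last time exists.
  have hc : IsCompact {r ∈ Icc t₀ t₁ | φ (u r) ≤ φ (u t₀)} := by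
    have hcont : ContinuousOn u (Icc t₀ t₁) :=
      h.continuousOn.mono fun x hx => lt_of_lt_of_le ht₀ hx.1
    have hcl : IsClosed {x | φ x ≤ φ (u t₀)} := hlsc.isClosed_preimage _
    exact isCompact_Icc.of_isClosed_subset
      (hcont.preimage_isClosed_of_isClosed isClosed_Icc hcl) (fun x hx => hx.1)
  obtain ⟨a, ⟨⟨ha0, ha1⟩, haφ⟩, hamax⟩ := hc.exists_isGreatest ⟨t₀, ⟨le_rfl, h01⟩, le_rfl⟩
  have hapos : 0 < a := lt_of_lt_of_le ht₀ ha0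
  have hle : ∀ {x y}, 0 < x → 0 < y → (φ (u x) ≤ φ (u y) ↔
      (φ (u x)).toReal ≤ (φ (u y)).toReal) := by
    intro x y hx hy
    rw [← EReal.coe_le_coe_iff, coe_toReal_of_mem_dom hbot (h.mem_dom x hx),
      coe_toReal_of_mem_dom hbot (h.mem_dom y hy)]
  have haφ' := (hle hapos ht₀).1 haφ
  have := h.sq_dist_le hbot hapos ha1 (h.mem_dom a hapos) (K := 0) (by
    rintro r ⟨har, hrt⟩
    rcases har.eq_or_lt with rfl | har
    · simp
    · by_contra! hcon
      have hr0 : 0 < r := hapos.trans har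
      have : r ≤ a := hamax ⟨⟨(ha0.trans har.le), hrt.le⟩, (hle hr0 ht₀).2 (by linarith)⟩
      linarith)
  simp only [dist_self, zero_mul, add_zero, ne_eq, OfNat.ofNat_ne_zero, not_false_eq_true,
    zero_pow] at this
  have h0 : dist (u t₁) (u a) ^ 2 = 0 := by
    exact le_antisymm (nonpos_of_mul_nonpos_right this (Real.exp_pos _)) (sq_nonneg _)
  have h1 : u t₁ = u a := dist_eq_zero.1 (pow_eq_zero_iff (two_ne_zero) |>.1 h0)
  rw [h1] at hlt
  exact absurd haφ' (not_le.2 hlt)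

end EVI

namespace EVI

variable {X : Type*} [MetricSpace X] {φ : X → EReal} {lam : ℝ} {D : Set X} {S : ℝ → X → X}

/-! ### Integral form of the Evolution Variational Inequality -/

theorem IsGradientFlow.mem_dom (hS : IsGradientFlow φ lam D S) {p : X} (hp : p ∈ D) {t : ℝ}
    (ht : 0 < t) : S t p ∈ dom φ :=
  (hS.solution p hp).mem_dom t ht

/-- By monotonicity the energy gap on `[s, h]` is bounded by its value at the final time; then the
starting time `s` tends to `0`. -/
theorem IsGradientFlow.exp_mul_sq_dist_le (hbot : ∀ x, φ x ≠ ⊥) (hlsc : LowerSemicontinuous φ)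
    (hS : IsGradientFlow φ lam D S) {p : X} (hp : p ∈ D) {h : ℝ} (hh : 0 < h) {v : X}
    (hv : v ∈ dom φ) :
    Real.exp (lam * h) * dist (S h p) v ^ 2
      ≤ dist p v ^ 2 + 2 * expPrimitive lam h * ((φ v).toReal - (φ (S h p)).toReal) := by
  have hsol := hS.solution p hp
  set K := 2 * ((φ v).toReal - (φ (S h p)).toReal) with hKdef
  have key : ∀ s ∈ Ioc 0 h, Real.exp (lam * (h - s)) * dist (S h p) v ^ 2
      ≤ dist (S s p) v ^ 2 + K * expPrimitive lam (h - s) := by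
    intro s hs
    refine hsol.sq_dist_le hbot hs.1 hs.2 hv ?_
    intro r hr
    have := hsol.antitoneOn hbot hlsc (mem_Ioi.2 (lt_of_lt_of_le hs.1 hr.1)) (mem_Ioi.2 hh)
      hr.2.le
    simp only at this
    linarith
  have hE := continuous_expPrimitive lam
  have h1 : Tendsto (fun s : ℝ => Real.exp (lam * (h - s)) * dist (S h p) v ^ 2) (𝓝[>] 0)
      (𝓝 (Real.exp (lam * (h - 0)) * dist (S h p) v ^ 2)) :=
    (Continuous.tendsto (by fun_prop) 0).mono_left nhdsWithin_le_nhds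
  have h2 : Tendsto (fun s : ℝ => K * expPrimitive lam (h - s)) (𝓝[>] 0)
      (𝓝 (K * expPrimitive lam (h - 0))) :=
    (Continuous.tendsto (by fun_prop) 0).mono_left nhdsWithin_le_nhds
  have h3 : Tendsto (fun s : ℝ => dist (S s p) v ^ 2) (𝓝[>] 0) (𝓝 (dist p v ^ 2)) :=
    ((hS.tendsto p hp).dist tendsto_const_nhds).pow 2
  have h4 := le_of_tendsto_of_tendsto h1 (h3.add h2) (by
    filter_upwards [Ioc_mem_nhdsGT hh] with s hs using key s hs)
  rw [sub_zero, hKdef] at h4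
  linarith

theorem IsGradientFlow.sq_dist_le (hbot : ∀ x, φ x ≠ ⊥) (hlsc : LowerSemicontinuous φ)
    (hS : IsGradientFlow φ lam D S) {p : X} (hp : p ∈ D) {h : ℝ} (hh : 0 < h) {v : X}
    (hv : v ∈ dom φ) :
    dist v (S h p) ^ 2 ≤ Real.exp (-(lam * h)) * dist v p ^ 2
      + 2 * (expPrimitive lam h * Real.exp (-(lam * h)))
        * ((φ v).toReal - (φ (S h p)).toReal) := by
  have h1 := mul_le_mul_of_nonneg_left (hS.exp_mul_sq_dist_le hbot hlsc hp hh hv)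
    (Real.exp_pos (-(lam * h))).le
  rw [← mul_assoc, ← Real.exp_add, neg_add_cancel, Real.exp_zero, one_mul, dist_comm,
    dist_comm p] at h1
  linarith

/-- The integrated inequality at time `1`, with its nonnegative left side dropped. -/
theorem IsGradientFlow.exists_quadratic_lower_bound (hbot : ∀ x, φ x ≠ ⊥)
    (hlsc : LowerSemicontinuous φ) (hS : IsGradientFlow φ lam D S) {p : X} (hp : p ∈ D) :
    ∃ k M : ℝ, 0 ≤ M ∧ ∀ y ∈ dom φ, k - M * dist p y ^ 2 ≤ (φ y).toReal := by
  have hE := expPrimitive_pos lam one_pos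
  refine ⟨(φ (S 1 p)).toReal, 1 / (2 * expPrimitive lam 1), by positivity, fun y hy => ?_⟩
  have h1 := hS.exp_mul_sq_dist_le hbot hlsc hp one_pos hy
  have h2 : 0 ≤ Real.exp (lam * 1) * dist (S 1 p) y ^ 2 := by positivity
  have h3 : 1 / (2 * expPrimitive lam 1) * dist p y ^ 2 =
    dist p y ^ 2 / (2 * expPrimitive lam 1) := by ring
  rw [h3, sub_le_iff_le_add, ← sub_le_iff_le_add', le_div_iff₀ (by positivity)]
  linarith

/-! ### Contraction -/

/-- Two one-step inequalities are chained: the flow from `x` tested at `y`, then the flow from `y`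
tested at `S h x`. The excess is `E(h)`, of order `h`, times an energy drop that telescopes plus a
term again of order `h`. -/
theorem IsGradientFlow.sq_dist_step (hbot : ∀ x, φ x ≠ ⊥) (hlsc : LowerSemicontinuous φ)
    (hS : IsGradientFlow φ lam D S) {x y : X} (hx : x ∈ D) (hy : y ∈ D) {h : ℝ} (hh : 0 < h)
    (hydom : y ∈ dom φ) :
    Real.exp (2 * lam * h) * dist (S h x) (S h y) ^ 2 ≤ dist x y ^ 2
      + 2 * expPrimitive lam h * (((φ y).toReal - (φ (S h y)).toReal)
        + (Real.exp (lam * h) - 1) * ((φ (S h x)).toReal - (φ (S h y)).toReal)) := by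
  have h1 := hS.exp_mul_sq_dist_le hbot hlsc hx hh hydom
  have h2 := mul_le_mul_of_nonneg_left
    (hS.exp_mul_sq_dist_le hbot hlsc hy hh (hS.mem_dom hx hh)) (Real.exp_pos (lam * h)).le
  have h3 : Real.exp (2 * lam * h) = Real.exp (lam * h) * Real.exp (lam * h) := by
    rw [← Real.exp_add]; ring_nf
  rw [dist_comm (S h y), dist_comm y] at h2
  rw [h3]
  linarith

/-- Summing `N` steps of length `(b - a) / N` leaves a total error of order `1 / N`. This avoids
differentiating the distance between two moving points. Starting at `a > 0` guarantees finite
energies. -/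
theorem IsGradientFlow.sq_dist_le_of_pos (hbot : ∀ x, φ x ≠ ⊥) (hlsc : LowerSemicontinuous φ)
    (hS : IsGradientFlow φ lam D S) {x y : X} (hx : x ∈ D) (hy : y ∈ D) {a b : ℝ} (ha : 0 < a)
    (hab : a < b) :
    Real.exp (2 * lam * (b - a)) * dist (S b x) (S b y) ^ 2 ≤ dist (S a x) (S a y) ^ 2 := by
  set f : ℝ → ℝ := fun t => (φ (S t x)).toReal with hf
  set g : ℝ → ℝ := fun t => (φ (S t y)).toReal with hg
  have hfa : AntitoneOn f (Ioi 0) := (hS.solution x hx).antitoneOn hbot hlsc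
  have hga : AntitoneOn g (Ioi 0) := (hS.solution y hy).antitoneOn hbot hlsc
  set T := b - a with hT
  have hTpos : 0 < T := sub_pos.2 hab
  have hb : 0 < b := ha.trans hab
  set C := |f a| + |f b| + |g a| + |g b| with hC
  have hCb : ∀ t ∈ Icc a b, |f t - g t| ≤ C := by
    intro t ht
    have ht0 : 0 < t := lt_of_lt_of_le ha ht.1
    have h1 := hfa ha ht0 ht.1
    have h2 := hfa ht0 hb ht.2
    have h3 := hga ha ht0 ht.1
    have h4 := hga ht0 hb ht.2
    have := le_abs_self (f a); have := neg_abs_le (f a)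
    have := le_abs_self (f b); have := neg_abs_le (f b)
    have := le_abs_self (g a); have := neg_abs_le (g a)
    have := le_abs_self (g b); have := neg_abs_le (g b)
    rw [abs_le]
    constructor <;> linarith
  have hC0 : 0 ≤ C := by positivity
  -- Two factors `e^{|λ|T}` bound the weight `e^{2λih}` and the third comes from `E(h) ≤ h
  -- e^{|λ|T}`.
  set M := 2 * Real.exp (3 * (|lam| * T)) with hM
  set C' := |lam| * Real.exp (|lam| * T) * C with hC'
  have hC'0 : 0 ≤ C' := by positivity
  have key : ∀ N : ℕ, 0 < N → Real.exp (2 * lam * T) * dist (S b x) (S b y) ^ 2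
      ≤ dist (S a x) (S a y) ^ 2 + T * M * (g a - g b + C' * T) / N := by
    intro N hN
    have hN' : (0 : ℝ) < N := by exact_mod_cast hN
    have hN1 : (1 : ℝ) ≤ N := by exact_mod_cast hN
    set h := T / N with hh
    have hhpos : 0 < h := by positivity
    have hhT : h ≤ T := div_le_self hTpos.le hN1
    have hNh : N * h = T := by rw [hh]; field_simp
    have ind : ∀ i : ℕ, i ≤ N →
        Real.exp (2 * lam * (i * h)) * dist (S (a + i * h) x) (S (a + i * h) y) ^ 2
        ≤ dist (S a x) (S a y) ^ 2 + h * M * (g a - g (a + i * h)) + h * M * (C' * (i * h)) := by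
      intro i
      induction i with
      | zero => intro _; simp
      | succ i ih =>
        intro hi
        have hi' : (i : ℝ) + 1 ≤ N := by exact_mod_cast hi
        have hih : ((i : ℝ) + 1) * h ≤ T := by
          rw [← hNh]; exact mul_le_mul_of_nonneg_right hi' hhpos.le
        have hi0 : 0 ≤ (i : ℝ) * h := by positivity
        specialize ih (by omega)
        have htpos : 0 < a + i * h := by linarith
        have hstep := hS.sq_dist_step hbot hlsc (hS.mapsTo _ htpos.le hx)
          (hS.mapsTo _ htpos.le hy) hhpos (hS.mem_dom hy htpos)
        rw [← hS.semigroup x hx _ _ htpos.le hhpos.le,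
          ← hS.semigroup y hy _ _ htpos.le hhpos.le] at hstep
        have heq : a + (i : ℝ) * h + h = a + ((i + 1 : ℕ) : ℝ) * h := by push_cast; ring
        rw [heq] at hstep
        have hgi : g (a + ((i + 1 : ℕ) : ℝ) * h) ≤ g (a + i * h) := by
          apply hga htpos (mem_Ioi.2 _)
          · rw [← heq]; linarith
          · rw [← heq]; linarith
        have hE0 := expPrimitive_nonneg lam hhpos.le
        have hE1 : expPrimitive lam h ≤ h * Real.exp (|lam| * T) :=
          (expPrimitive_le lam hhpos.le).trans (by gcongr)
        have hexp : (Real.exp (lam * h) - 1) *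
            (f (a + ((i + 1 : ℕ) : ℝ) * h) - g (a + ((i + 1 : ℕ) : ℝ) * h)) ≤ h * C' := by
          rw [← mul_expPrimitive]
          calc _ ≤ |lam * expPrimitive lam h *
                (f (a + ((i + 1 : ℕ) : ℝ) * h) - g (a + ((i + 1 : ℕ) : ℝ) * h))| :=
                le_abs_self _
            _ = |lam| * expPrimitive lam h *
                |f (a + ((i + 1 : ℕ) : ℝ) * h) - g (a + ((i + 1 : ℕ) : ℝ) * h)| := by
                rw [abs_mul, abs_mul, abs_of_nonneg hE0]
            _ ≤ |lam| * (h * Real.exp (|lam| * T)) * C := by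
                gcongr
                apply hCb
                rw [← heq]
                constructor <;> linarith
            _ = h * C' := by rw [hC']; ring
        have hexpi : Real.exp (2 * lam * (i * h)) ≤ Real.exp (2 * (|lam| * T)) := by
          apply Real.exp_le_exp.2
          have h1 : lam * (i * h) ≤ |lam| * (i * h) :=
            mul_le_mul_of_nonneg_right (le_abs_self _) hi0
          have h2 : |lam| * (i * h) ≤ |lam| * T :=
            mul_le_mul_of_nonneg_left (by linarith) (abs_nonneg _)
          linarith
        have hME : Real.exp (2 * lam * (i * h)) * (2 * expPrimitive lam h) ≤ h * M := by
          calc _ ≤ Real.exp (2 * (|lam| * T)) * (2 * (h * Real.exp (|lam| * T))) := by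
                gcongr
            _ = h * M := by
                rw [hM, show 3 * (|lam| * T) = 2 * (|lam| * T) + |lam| * T by ring,
                  Real.exp_add]
                ring
        have hsplit : Real.exp (2 * lam * (((i + 1 : ℕ) : ℝ) * h)) =
            Real.exp (2 * lam * (i * h)) * Real.exp (2 * lam * h) := by
          rw [← Real.exp_add]; push_cast; ring_nf
        have hbr : 0 ≤ g (a + i * h) - g (a + ((i + 1 : ℕ) : ℝ) * h) + h * C' := by
          have : 0 ≤ h * C' := by positivity
          linarith
        calc _ = Real.exp (2 * lam * (i * h)) * (Real.exp (2 * lam * h) *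
              dist (S (a + ((i + 1 : ℕ) : ℝ) * h) x) (S (a + ((i + 1 : ℕ) : ℝ) * h) y) ^ 2) := by
              rw [hsplit, mul_assoc]
          _ ≤ Real.exp (2 * lam * (i * h)) * (dist (S (a + i * h) x) (S (a + i * h) y) ^ 2 +
              2 * expPrimitive lam h *
                (g (a + i * h) - g (a + ((i + 1 : ℕ) : ℝ) * h) + h * C')) := by
              refine mul_le_mul_of_nonneg_left (hstep.trans ?_) (Real.exp_pos _).le
              have : 2 * expPrimitive lam h * _ ≤ 2 * expPrimitive lam h * _ :=
                mul_le_mul_of_nonneg_left (add_le_add_right hexp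
                  (g (a + i * h) - g (a + ((i + 1 : ℕ) : ℝ) * h))) (by positivity)
              exact add_le_add_right this _
          _ = Real.exp (2 * lam * (i * h)) * dist (S (a + i * h) x) (S (a + i * h) y) ^ 2 +
              Real.exp (2 * lam * (i * h)) * (2 * expPrimitive lam h) *
                (g (a + i * h) - g (a + ((i + 1 : ℕ) : ℝ) * h) + h * C') := by ring
          _ ≤ (dist (S a x) (S a y) ^ 2 + h * M * (g a - g (a + i * h))
                + h * M * (C' * (i * h))) +
              h * M * (g (a + i * h) - g (a + ((i + 1 : ℕ) : ℝ) * h) + h * C') :=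
              add_le_add ih (mul_le_mul_of_nonneg_right hME hbr)
          _ = _ := by push_cast; ring
    have hfin := ind N le_rfl
    rw [hNh, show a + T = b by rw [hT]; ring] at hfin
    calc _ ≤ _ := hfin
      _ = _ := by rw [hh]; ring
  have hlim : Tendsto (fun N : ℕ => dist (S a x) (S a y) ^ 2 +
      T * M * (g a - g b + C' * T) / N) atTop (𝓝 (dist (S a x) (S a y) ^ 2 + 0)) :=
    tendsto_const_nhds.add (tendsto_const_div_atTop_nhds_zero_nat _)
  rw [add_zero] at hlim
  exact ge_of_tendsto hlim ((eventually_gt_atTop 0).mono key)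

theorem IsGradientFlow.sq_dist_contraction (hbot : ∀ x, φ x ≠ ⊥) (hlsc : LowerSemicontinuous φ)
    (hS : IsGradientFlow φ lam D S) {x y : X} (hx : x ∈ D) (hy : y ∈ D) {t : ℝ} (ht : 0 ≤ t) :
    dist (S t x) (S t y) ^ 2 ≤ Real.exp (-(2 * lam * t)) * dist x y ^ 2 := by
  rcases ht.eq_or_lt with rfl | ht
  · simp [hS.zero x hx, hS.zero y hy]
  have h1 : Tendsto (fun a : ℝ => Real.exp (2 * lam * (t - a)) * dist (S t x) (S t y) ^ 2)
      (𝓝[>] 0) (𝓝 (Real.exp (2 * lam * (t - 0)) * dist (S t x) (S t y) ^ 2)) :=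
    (Continuous.tendsto (by fun_prop) 0).mono_left nhdsWithin_le_nhds
  have h2 : Tendsto (fun a : ℝ => dist (S a x) (S a y) ^ 2) (𝓝[>] 0) (𝓝 (dist x y ^ 2)) :=
    ((hS.tendsto x hx).dist (hS.tendsto y hy)).pow 2
  have h3 := le_of_tendsto_of_tendsto h1 h2 (by
    filter_upwards [Ioo_mem_nhdsGT ht] with a ha
      using hS.sq_dist_le_of_pos hbot hlsc hx hy ha.1 ha.2)
  rw [sub_zero] at h3
  have h4 := mul_le_mul_of_nonneg_left h3 (Real.exp_pos (-(2 * lam * t))).le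
  rwa [← mul_assoc, ← Real.exp_add, neg_add_cancel, Real.exp_zero, one_mul] at h4

end EVI

namespace EVI

/-! ### The convexity estimate -/

theorem mul_sq_add_le (θ a b : ℝ) :
    θ * (1 - θ) * (a + b) ^ 2 ≤ (1 - θ) * a ^ 2 + θ * b ^ 2 := by
  nlinarith [sq_nonneg ((1 - θ) * a - θ * b)]

theorem mul_sq_le_of_le_add {θ : ℝ} (hθ : θ ∈ Ioo (0 : ℝ) 1) {a b d : ℝ} (hd : 0 ≤ d)
    (h : d ≤ a + b) : θ * (1 - θ) * d ^ 2 ≤ (1 - θ) * a ^ 2 + θ * b ^ 2 := by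
  have h1 : 0 ≤ θ * (1 - θ) := mul_nonneg hθ.1.le (sub_nonneg.2 hθ.2.le)
  exact (mul_le_mul_of_nonneg_left (pow_le_pow_left₀ hd h 2) h1).trans (mul_sq_add_le θ a b)

theorem isIntermediatePoint_iff {X : Type*} {d : X → X → ℝ} {θ ε : ℝ} (hθ : θ ∈ Ioo (0 : ℝ) 1)
    {x₀ x₁ x : X} : IsIntermediatePoint d θ ε x₀ x₁ x ↔
      (1 - θ) * d x₀ x ^ 2 + θ * d x x₁ ^ 2
        ≤ θ * (1 - θ) * d x₀ x₁ ^ 2 * (1 + ε ^ 2 * θ * (1 - θ)) := by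
  have h1 : 0 < θ := hθ.1
  have h2 : 0 < 1 - θ := sub_pos.2 hθ.2
  rw [IsIntermediatePoint, div_add_div _ _ h1.ne' h2.ne', div_le_iff₀ (by positivity)]
  constructor <;> intro h <;> linarith

/-- The algebra common to both distances: `a`, `b` are the distances from `x₀`, `x₁` to the evolved
point, `a₀`, `b₀` those to the starting point, and `A`, `B` the coefficients of the flow estimate.
-/
theorem convex_combination_estimate {θ A B a b a₀ b₀ d f₀ f₁ g ε : ℝ} (hθ : θ ∈ Ioo (0 : ℝ) 1)
    (hA : 0 ≤ A) (hd : 0 ≤ d) (hdab : d ≤ a + b)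
    (ha : a ^ 2 ≤ A * a₀ ^ 2 + 2 * B * (f₀ - g)) (hb : b ^ 2 ≤ A * b₀ ^ 2 + 2 * B * (f₁ - g))
    (hmid : (1 - θ) * a₀ ^ 2 + θ * b₀ ^ 2
      ≤ θ * (1 - θ) * d ^ 2 * (1 + ε ^ 2 * θ * (1 - θ))) :
    2 * B * g ≤ 2 * B * ((1 - θ) * f₀ + θ * f₁)
      - ((1 - A) - A * ε ^ 2 * θ * (1 - θ)) * (θ * (1 - θ) * d ^ 2) := by
  have h0 := mul_sq_le_of_le_add hθ hd hdab
  have h1 := mul_le_mul_of_nonneg_left ha (sub_nonneg.2 hθ.2.le)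
  have h2 := mul_le_mul_of_nonneg_left hb hθ.1.le
  have h3 := mul_le_mul_of_nonneg_left hmid hA
  linarith

theorem le_convex_combination_iff {X : Type*} {φ : X → EReal} (hbot : ∀ x, φ x ≠ ⊥)
    {x₀ x₁ y : X} (h₀ : x₀ ∈ dom φ) (h₁ : x₁ ∈ dom φ) (hy : y ∈ dom φ) (θ R : ℝ) :
    φ y ≤ ((1 - θ : ℝ) : EReal) * φ x₀ + (θ : EReal) * φ x₁ - (R : EReal) ↔
      (φ y).toReal ≤ (1 - θ) * (φ x₀).toReal + θ * (φ x₁).toReal - R := by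
  rw [← coe_toReal_of_mem_dom hbot h₀, ← coe_toReal_of_mem_dom hbot h₁,
    ← coe_toReal_of_mem_dom hbot hy]
  norm_cast

variable {X : Type*} [MetricSpace X] {φ : X → EReal} {lam : ℝ} {D : Set X} {S : ℝ → X → X}

theorem IsGradientFlow.le_at_intermediatePoint (hbot : ∀ x, φ x ≠ ⊥)
    (hlsc : LowerSemicontinuous φ) (hS : IsGradientFlow φ lam D S) {x₀ x₁ : X}
    (h₀ : x₀ ∈ dom φ) (h₁ : x₁ ∈ dom φ) {θ ε : ℝ} (hθ : θ ∈ Ioo (0 : ℝ) 1) {x : X} (hx : x ∈ D)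
    (hmid : IsIntermediatePoint dist θ ε x₀ x₁ x) {t : ℝ} (ht : 0 < t) :
    (φ (S t x)).toReal ≤ (1 - θ) * (φ x₀).toReal + θ * (φ x₁).toReal
      - 1 / 2 * (lam - ε ^ 2 / expPrimitive lam t) * θ * (1 - θ) * dist x₀ x₁ ^ 2 := by
  have hE := expPrimitive_pos lam ht
  have ha := hS.sq_dist_le hbot hlsc hx ht h₀
  have hb := hS.sq_dist_le hbot hlsc hx ht h₁
  rw [isIntermediatePoint_iff hθ, dist_comm x x₁] at hmid
  have hmain := convex_combination_estimate hθ (Real.exp_pos _).le dist_nonneg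
    (dist_triangle_right x₀ x₁ (S t x)) ha hb hmid
  have hexp : Real.exp (lam * t) * Real.exp (-(lam * t)) = 1 := by
    rw [← Real.exp_add]; simp
  have hlam := mul_expPrimitive lam t
  set E := expPrimitive lam t
  set e := Real.exp (-(lam * t))
  set c := θ * (1 - θ) * dist x₀ x₁ ^ 2 with hc
  set m := (1 - θ) * (φ x₀).toReal + θ * (φ x₁).toReal
  set g := (φ (S t x)).toReal
  have hθ1 : 0 ≤ θ * (1 - θ) := mul_nonneg hθ.1.le (sub_nonneg.2 hθ.2.le)
  have hθ2 : θ * (1 - θ) ≤ 1 := by nlinarith [sq_nonneg θ, hθ.1, hθ.2]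
  have hc0 : 0 ≤ c := by positivity
  -- Multiplying by `e^{λt}` cancels the exponential in `B` and turns `1 - A` into `λ E`.
  have h1 := mul_le_mul_of_nonneg_left hmain (Real.exp_pos (lam * t)).le
  have h2 : 2 * E * g ≤ 2 * E * m - (lam * E - ε ^ 2 * (θ * (1 - θ))) * c := by
    rw [hlam]
    linear_combination h1 + (2 * E * (m - g) + c * (1 + ε ^ 2 * (θ * (1 - θ)))) * hexp
  have h3 : ε ^ 2 * (θ * (1 - θ)) * c ≤ ε ^ 2 * 1 * c := by gcongr
  have h4 : 2 * E * g ≤ 2 * E * m - (lam * E - ε ^ 2) * c := by linarith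
  have h5 : 2 * E * (m - 1 / 2 * (lam - ε ^ 2 / E) * c) =
      2 * E * m - (lam * E - ε ^ 2) * c := by field_simp
  have h6 : g ≤ m - 1 / 2 * (lam - ε ^ 2 / E) * c := by
    refine le_of_mul_le_mul_left ?_ (by positivity : 0 < 2 * E)
    rw [h5]; exact h4
  calc g ≤ _ := h6
    _ = _ := by rw [hc]; ring

theorem IsGeodesicIn.isIntermediatePoint {x₀ x₁ : X} {γ : ℝ → X} (hγ : IsGeodesicIn D x₀ x₁ γ)
    {t : ℝ} (ht : t ∈ Ioo (0 : ℝ) 1) (ε : ℝ) :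
    IsIntermediatePoint dist t ε x₀ x₁ (γ t) := by
  have h0 := hγ.dist_eq 0 ⟨le_rfl, zero_le_one⟩ t ⟨ht.1.le, ht.2.le⟩ ht.1
  have h1 := hγ.dist_eq t ⟨ht.1.le, ht.2.le⟩ 1 ⟨zero_le_one, le_rfl⟩ ht.2
  rw [hγ.start, hγ.finish] at h0 h1
  have ht2 : 0 < 1 - t := sub_pos.2 ht.2
  have ht1 := ht.1
  rw [isIntermediatePoint_iff ht, h0, h1]
  have : 0 ≤ t * (1 - t) * dist x₀ x₁ ^ 2 * (ε ^ 2 * t * (1 - t)) := by positivity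
  linarith

theorem IsGradientFlow.convexAlong (hbot : ∀ x, φ x ≠ ⊥) (hlsc : LowerSemicontinuous φ)
    (hS : IsGradientFlow φ lam D S) {x₀ x₁ : X} (h₀ : x₀ ∈ dom φ) (h₁ : x₁ ∈ dom φ) {γ : ℝ → X}
    (hγ : IsGeodesicIn D x₀ x₁ γ) : ConvexAlong φ lam γ := by
  intro t ht
  rcases ht.1.eq_or_lt with rfl | ht0
  · rw [hγ.start, hγ.finish, le_convex_combination_iff hbot h₀ h₁ h₀]
    simp
  rcases ht.2.eq_or_lt with rfl | ht1
  · rw [hγ.start, hγ.finish, le_convex_combination_iff hbot h₀ h₁ h₁]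
    simp
  have hθ : t ∈ Ioo (0 : ℝ) 1 := ⟨ht0, ht1⟩
  have hmem := hγ.mem t ht
  rw [hγ.start, hγ.finish]
  have hs : ∀ s : ℝ, 0 < s → φ (S s (γ t)) ≤ ((1 - t : ℝ) : EReal) * φ x₀ + (t : EReal) * φ x₁
      - ((lam / 2 * t * (1 - t) * dist x₀ x₁ ^ 2 : ℝ) : EReal) := by
    intro s hs
    rw [le_convex_combination_iff hbot h₀ h₁ (hS.mem_dom hmem hs)]
    -- With `ε = 0` the singular term `ε² / E(s)` vanishes, so the bound does not depend on `s`.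
    have := hS.le_at_intermediatePoint hbot hlsc h₀ h₁ hθ hmem
      (hγ.isIntermediatePoint hθ 0) hs
    simp only [ne_eq, OfNat.ofNat_ne_zero, not_false_eq_true, zero_pow, zero_div,
      sub_zero] at this
    linarith
  exact (hlsc.isClosed_preimage _).mem_of_tendsto (hS.tendsto _ hmem)
    (eventually_mem_nhdsWithin.mono hs)

/-! ### Approximate convexity from a regularizing flow -/

theorem approxConvexIn_of_regularizing (hbot : ∀ x, φ x ≠ ⊥) {ρ : X → X → ℝ} {C : Set X}
    {A B : ℝ → ℝ} (hρ : ∀ x ∈ C, ∀ y ∈ C, dist x y ≤ ρ x y) (hself : ∀ x ∈ C, ρ x x = 0)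
    (htri : ∀ x ∈ C, ∀ y ∈ C, ∀ z ∈ C, ρ x z ≤ ρ x y + ρ y z)
    (hsymm : ∀ x ∈ C, ∀ y ∈ C, ρ x y = ρ y x)
    (hlow : ∀ x ∈ C, ∃ k M : ℝ, 0 ≤ M ∧ ∀ y ∈ dom φ, k - M * dist x y ^ 2 ≤ (φ y).toReal)
    (hstep : ∀ v ∈ C ∩ dom φ, ∀ p ∈ C, ∀ t, 0 < t → S t p ∈ C ∩ dom φ ∧
      ρ v (S t p) ^ 2 ≤ A t * ρ v p ^ 2 + 2 * B t * ((φ v).toReal - (φ (S t p)).toReal))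
    (hA : ∀ t, 0 < t → 0 ≤ A t) (hB : ∀ t, 0 < t → 0 < B t)
    (hB0 : Tendsto B (𝓝[>] 0) (𝓝 0))
    (hAB : Tendsto (fun t => (1 - A t) / B t) (𝓝[>] 0) (𝓝 lam))
    (hmid : ∀ x₀ ∈ C, ∀ x₁ ∈ C, 0 < ρ x₀ x₁ → ∀ θ ∈ Ioo (0 : ℝ) 1, ∀ ε ∈ Ioo (0 : ℝ) 1,
      ∃ x ∈ C, IsIntermediatePoint ρ θ ε x₀ x₁ x) :
    ApproxConvexIn ρ φ lam C := by
  rintro x₀ ⟨hx₀, h₀⟩ x₁ ⟨hx₁, h₁⟩ θ hθ ε hε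
  have hε0 := hε.1
  have hθ0 := hθ.1
  have hθ1 : 0 < 1 - θ := sub_pos.2 hθ.2
  set d := ρ x₀ x₁ with hd
  have hd0 : 0 ≤ d := dist_nonneg.trans (hρ _ hx₀ _ hx₁)
  rcases hd0.eq_or_lt with hdz | hdpos
  · have hx : x₀ = x₁ := dist_le_zero.1 ((hρ _ hx₀ _ hx₁).trans hdz.symm.le)
    subst hx
    refine ⟨x₀, hx₀, ?_, ?_⟩
    · rw [isIntermediatePoint_iff hθ, hself _ hx₀]; simp
    · rw [← hdz, le_convex_combination_iff hbot h₀ h₀ h₀]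
      apply le_of_eq; ring
  obtain ⟨k, M, hM, hlow⟩ := hlow x₀ hx₀
  set m := (1 - θ) * (φ x₀).toReal + θ * (φ x₁).toReal with hm
  set c := θ * (1 - θ) with hc
  have hcpos : 0 < c := by positivity
  have hA1 : Tendsto A (𝓝[>] 0) (𝓝 1) := by
    have h1 : Tendsto (fun t => 1 - (1 - A t) / B t * B t) (𝓝[>] 0) (𝓝 (1 - lam * 0)) :=
      tendsto_const_nhds.sub (hAB.mul hB0)
    rw [mul_zero, sub_zero] at h1
    refine h1.congr' ?_
    filter_upwards [self_mem_nhdsWithin] with t ht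
    rw [div_mul_cancel₀ _ (hB t ht).ne', sub_sub_cancel]
  have ev1 : ∀ᶠ t in 𝓝[>] 0, lam - ε / 2 < (1 - A t) / B t :=
    hAB.eventually_const_lt (by linarith)
  -- This coefficient remains in front of the weighted squared distance once the quadratic lower
  -- bound on `φ` is absorbed on the left.
  have ev2 : ∀ᶠ t in 𝓝[>] 0, 0 < 1 - 2 * B t * M / (1 - θ) := by
    have h1 : Tendsto (fun t => 1 - 2 * B t * M / (1 - θ)) (𝓝[>] 0)
        (𝓝 (1 - 2 * 0 * M / (1 - θ))) :=
      tendsto_const_nhds.sub (((tendsto_const_nhds.mul hB0).mul_const M).div_const _)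
    exact h1.eventually_const_lt (by simp)
  -- As `t ↓ 0` the two sides differ by the gap between `ε² / 2` and `ε²`; that gap pays for keeping
  -- `S t x` intermediate.
  have ev3 : ∀ᶠ t in 𝓝[>] 0, A t * (c * d ^ 2 * (1 + ε ^ 2 / 2 * c)) + 2 * B t * (m - k)
      < (1 - 2 * B t * M / (1 - θ)) * (c * d ^ 2 * (1 + ε ^ 2 * c)) := by
    have h1 : Tendsto (fun t => A t * (c * d ^ 2 * (1 + ε ^ 2 / 2 * c)) + 2 * B t * (m - k))
        (𝓝[>] 0) (𝓝 (1 * (c * d ^ 2 * (1 + ε ^ 2 / 2 * c)) + 2 * 0 * (m - k))) :=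
      (hA1.mul_const _).add ((tendsto_const_nhds.mul hB0).mul_const _)
    have h2 : Tendsto (fun t => (1 - 2 * B t * M / (1 - θ)) * (c * d ^ 2 * (1 + ε ^ 2 * c)))
        (𝓝[>] 0) (𝓝 ((1 - 2 * 0 * M / (1 - θ)) * (c * d ^ 2 * (1 + ε ^ 2 * c)))) :=
      (tendsto_const_nhds.sub
        (((tendsto_const_nhds.mul hB0).mul_const M).div_const _)).mul_const _
    refine h1.eventually_lt h2 ?_
    have : 0 < c * d ^ 2 * (ε ^ 2 / 2 * c) := by positivity
    simp only [mul_zero, zero_mul, zero_div, sub_zero, one_mul, add_zero]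
    linarith
  obtain ⟨t, ⟨⟨ht1, ht2⟩, ht3⟩, ht⟩ :=
    (((ev1.and ev2).and ev3).and (self_mem_nhdsWithin (a := (0 : ℝ)) (s := Ioi 0))).exists
  have htpos : 0 < t := ht
  have hBt := hB t htpos
  have hAt := hA t htpos
  -- Chosen after `t`: the error `A ε'² c` has to be small compared with `B t`.
  obtain ⟨ε', hε'0, hε'1, hε'2, hε'3⟩ : ∃ ε' : ℝ, 0 < ε' ∧ ε' < 1 ∧ ε' ^ 2 ≤ ε ^ 2 / 2 ∧
      A t * ε' ^ 2 * c ≤ ε / 2 * B t := by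
    have hT : Tendsto (fun e : ℝ => A t * e ^ 2 * c) (𝓝[>] 0) (𝓝 (A t * 0 ^ 2 * c)) :=
      (Continuous.tendsto (by fun_prop) 0).mono_left nhdsWithin_le_nhds
    have hT2 : Tendsto (fun e : ℝ => e ^ 2) (𝓝[>] 0) (𝓝 (0 ^ 2)) :=
      (Continuous.tendsto (by fun_prop) 0).mono_left nhdsWithin_le_nhds
    have e1 := hT.eventually_lt_const (u := ε / 2 * B t) (by simp; positivity)
    have e2 := hT2.eventually_lt_const (u := ε ^ 2 / 2) (by simp; positivity)
    obtain ⟨e, ⟨h1, h2⟩, h3⟩ := ((e1.and e2).and (Ioo_mem_nhdsGT zero_lt_one)).exists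
    exact ⟨e, h3.1, h3.2, h2.le, h1.le⟩
  obtain ⟨x, hx, hxmid⟩ := hmid x₀ hx₀ x₁ hx₁ hdpos θ hθ ε' ⟨hε'0, hε'1⟩
  obtain ⟨hu, ha⟩ := hstep x₀ ⟨hx₀, h₀⟩ x hx t htpos
  obtain ⟨-, hb⟩ := hstep x₁ ⟨hx₁, h₁⟩ x hx t htpos
  rw [isIntermediatePoint_iff hθ, hsymm x hx x₁ hx₁, ← hd] at hxmid
  have hdu : d ≤ ρ x₀ (S t x) + ρ x₁ (S t x) := by
    rw [hsymm x₁ hx₁ _ hu.1]; exact htri _ hx₀ _ hu.1 _ hx₁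
  have hest := convex_combination_estimate hθ hAt hd0 hdu ha hb hxmid
  refine ⟨S t x, hu.1, ?_, ?_⟩
  · rw [isIntermediatePoint_iff hθ, hsymm _ hu.1 x₁ hx₁, ← hd]
    have hk := hlow _ hu.2
    have hdist : dist x₀ (S t x) ^ 2 ≤ ρ x₀ (S t x) ^ 2 :=
      pow_le_pow_left₀ dist_nonneg (hρ _ hx₀ _ hu.1) 2
    set a := ρ x₀ (S t x)
    set b := ρ x₁ (S t x)
    set g := (φ (S t x)).toReal
    set q := (1 - θ) * a ^ 2 + θ * b ^ 2 with hq
    have hqa : (1 - θ) * a ^ 2 ≤ q := by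
      have : 0 ≤ θ * b ^ 2 := by positivity
      linarith
    have hg : k - M * a ^ 2 ≤ g := by
      have := mul_le_mul_of_nonneg_left hdist hM
      linarith
    have hq1 : q ≤ A t * (c * d ^ 2 * (1 + ε' ^ 2 * c)) + 2 * B t * (m - g) := by
      have h1 := mul_le_mul_of_nonneg_left ha hθ1.le
      have h2 := mul_le_mul_of_nonneg_left hb hθ0.le
      have h3 := mul_le_mul_of_nonneg_left hxmid hAt
      rw [hq, hm, hc]
      linarith
    have hq2 : A t * (c * d ^ 2 * (1 + ε' ^ 2 * c)) ≤
        A t * (c * d ^ 2 * (1 + ε ^ 2 / 2 * c)) := by gcongr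
    have hq3 : 2 * B t * (m - g) ≤ 2 * B t * (m - k) + 2 * B t * M * a ^ 2 := by
      have := mul_le_mul_of_nonneg_left hg (by positivity : 0 ≤ 2 * B t)
      linarith
    have hq4 : 2 * B t * M * a ^ 2 ≤ 2 * B t * M / (1 - θ) * q := by
      have := mul_le_mul_of_nonneg_left hqa (by positivity : 0 ≤ 2 * B t * M / (1 - θ))
      refine le_trans (le_of_eq ?_) this
      field_simp
    have hq5 : (1 - 2 * B t * M / (1 - θ)) * q ≤
        (1 - 2 * B t * M / (1 - θ)) * (c * d ^ 2 * (1 + ε ^ 2 * c)) := by linarith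
    have hq6 := le_of_mul_le_mul_left hq5 ht2
    calc q ≤ _ := hq6
      _ = _ := by rw [hc]; ring
  · rw [le_convex_combination_iff hbot h₀ h₁ hu.2]
    set g := (φ (S t x)).toReal
    have hcd : 0 ≤ c * d ^ 2 := by positivity
    have h1 : (lam - ε) * B t ≤ (1 - A t) - A t * ε' ^ 2 * c := by
      rw [lt_div_iff₀ hBt] at ht1
      linarith
    have h2 := mul_le_mul_of_nonneg_right h1 hcd
    refine le_of_mul_le_mul_left (?_ : 2 * B t * g ≤ 2 * B t * _) (by positivity)
    calc 2 * B t * g ≤ _ := hest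
      _ ≤ _ := by rw [← hm, ← hc, mul_assoc, mul_assoc, mul_assoc, mul_assoc]; linarith

/-! ### Approximate length subsets -/

/-- The midpoint condition bounds `(a + b)² + (a - b)²`. Since `a + b ≥ d`, it makes `a - b` small
and `a + b` close to `d`, hence controls each of `a`, `b`. -/
theorem IsApproxLength.exists_midpoint (hD : IsApproxLength D) {x₀ x₁ : X} (hx₀ : x₀ ∈ D)
    (hx₁ : x₁ ∈ D) {δ : ℝ} (hδ : 0 < δ) :
    ∃ x ∈ D, dist x₀ x ≤ (1 + δ) * (dist x₀ x₁ / 2) ∧ dist x x₁ ≤ (1 + δ) * (dist x₀ x₁ / 2) := by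
  set e := min δ (1 / 2) with he
  have he0 : 0 < e := lt_min hδ (by norm_num)
  have he1 : e ≤ 1 / 2 := min_le_right _ _
  have heδ : e ≤ δ := min_le_left _ _
  obtain ⟨x, hx, hmid⟩ := hD x₀ hx₀ x₁ hx₁ e ⟨he0, by linarith⟩
  rw [isIntermediatePoint_iff (by norm_num)] at hmid
  have htri := dist_triangle x₀ x x₁
  have ha : 0 ≤ dist x₀ x := dist_nonneg
  have hb : 0 ≤ dist x x₁ := dist_nonneg
  have hd : 0 ≤ dist x₀ x₁ := dist_nonneg
  refine ⟨x, hx, ?_⟩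
  set a := dist x₀ x
  set b := dist x x₁
  set d := dist x₀ x₁
  have h1 : (a + b) ^ 2 + (a - b) ^ 2 ≤ d ^ 2 * (1 + e ^ 2 / 4) := by linarith
  have h2 : |a - b| ≤ d * e / 2 := by
    apply abs_le_of_sq_le_sq _ (by positivity)
    nlinarith
  have h3 : a + b ≤ d * (1 + e ^ 2 / 4) := by
    apply le_of_sq_le_sq _ (by positivity)
    nlinarith [sq_nonneg (a - b), mul_nonneg (sq_nonneg d) (sq_nonneg e),
      mul_nonneg (sq_nonneg d) (sq_nonneg (e ^ 2))]
  have h4 : d * (1 + e ^ 2 / 4) + d * e / 2 ≤ (1 + δ) * d := by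
    have : 1 + e ^ 2 / 4 + e / 2 ≤ 1 + δ := by nlinarith
    nlinarith
  obtain ⟨h5, h6⟩ := abs_le.1 h2
  constructor <;> linarith

/-- Bisection: each step keeps the half containing `θ` and rescales `θ` to `2θ` or `2θ - 1`. The
term `(1/2)^n` is the error in locating `θ` after `n` steps. -/
theorem IsApproxLength.exists_dist_le (hD : IsApproxLength D) (n : ℕ) :
    ∀ θ ∈ Icc (0 : ℝ) 1, ∀ δ > 0, ∀ x₀ ∈ D, ∀ x₁ ∈ D, ∃ x ∈ D,
      dist x₀ x ≤ (1 + δ) * (θ + (1 / 2) ^ n) * dist x₀ x₁ ∧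
      dist x x₁ ≤ (1 + δ) * (1 - θ + (1 / 2) ^ n) * dist x₀ x₁ := by
  induction n with
  | zero =>
    rintro θ ⟨h0, h1⟩ δ hδ x₀ hx₀ x₁ hx₁
    refine ⟨x₀, hx₀, by rw [dist_self]; positivity, ?_⟩
    refine le_mul_of_one_le_left dist_nonneg ?_
    rw [pow_zero]
    nlinarith
  | succ n ih =>
    rintro θ ⟨h0, h1⟩ δ hδ x₀ hx₀ x₁ hx₁
    -- The midpoint error and the inductive error multiply.
    obtain ⟨η, hη, hηδ⟩ : ∃ η : ℝ, 0 < η ∧ (1 + η) * (1 + η) ≤ 1 + δ := by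
      refine ⟨min 1 (δ / 3), by positivity, ?_⟩
      have ha : min 1 (δ / 3) ≤ 1 := min_le_left _ _
      have hb : min 1 (δ / 3) ≤ δ / 3 := min_le_right _ _
      have hc : 0 < min 1 (δ / 3) := by positivity
      nlinarith
    obtain ⟨z, hz, hz0, hz1⟩ := hD.exists_midpoint hx₀ hx₁ hη
    set d := dist x₀ x₁ with hd
    have hd0 : 0 ≤ d := dist_nonneg
    have hη1 : 1 + η ≤ (1 + η) * (1 + η) := by nlinarith
    have hpn : (0 : ℝ) < (1 / 2) ^ n := by positivity
    have hps : ((1 : ℝ) / 2) ^ (n + 1) = (1 / 2) ^ n / 2 := by rw [pow_succ]; ring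
    rw [hps]
    set κ := ((1 : ℝ) / 2) ^ n
    rcases le_total θ (1 / 2) with hθ | hθ
    · obtain ⟨x, hx, hxa, hxb⟩ := ih (2 * θ) ⟨by linarith, by linarith⟩ η hη x₀ hx₀ z hz
      refine ⟨x, hx, ?_, ?_⟩
      · calc dist x₀ x ≤ _ := hxa
          _ ≤ (1 + η) * (2 * θ + κ) * ((1 + η) * (d / 2)) := by gcongr
          _ = (1 + η) * (1 + η) * ((θ + κ / 2) * d) := by ring
          _ ≤ (1 + δ) * ((θ + κ / 2) * d) := by gcongr
          _ = _ := by ring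
      · have hnn : 0 ≤ 1 - 2 * θ + κ := by linarith
        have hnn2 : 0 ≤ (1 - θ + κ / 2) * d := mul_nonneg (by linarith) hd0
        calc dist x x₁ ≤ dist x z + dist z x₁ := dist_triangle _ _ _
          _ ≤ (1 + η) * (1 - 2 * θ + κ) * ((1 + η) * (d / 2)) + (1 + η) * (d / 2) := by
              refine add_le_add (hxb.trans ?_) hz1
              gcongr
          _ ≤ (1 + η) * (1 - 2 * θ + κ) * ((1 + η) * (d / 2))
                + (1 + η) * (1 + η) * (d / 2) := by gcongr
          _ = (1 + η) * (1 + η) * ((1 - θ + κ / 2) * d) := by ring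
          _ ≤ (1 + δ) * ((1 - θ + κ / 2) * d) := by gcongr
          _ = _ := by ring
    · obtain ⟨x, hx, hxa, hxb⟩ := ih (2 * θ - 1) ⟨by linarith, by linarith⟩ η hη z hz x₁ hx₁
      refine ⟨x, hx, ?_, ?_⟩
      · have hnn : 0 ≤ 2 * θ - 1 + κ := by linarith
        calc dist x₀ x ≤ dist x₀ z + dist z x := dist_triangle _ _ _
          _ ≤ (1 + η) * (d / 2) + (1 + η) * (2 * θ - 1 + κ) * ((1 + η) * (d / 2)) := by
              refine add_le_add hz0 (hxa.trans ?_)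
              gcongr
          _ ≤ (1 + η) * (1 + η) * (d / 2)
                + (1 + η) * (2 * θ - 1 + κ) * ((1 + η) * (d / 2)) := by gcongr
          _ = (1 + η) * (1 + η) * ((θ + κ / 2) * d) := by ring
          _ ≤ (1 + δ) * ((θ + κ / 2) * d) := by gcongr
          _ = _ := by ring
      · have hnn : 0 ≤ 1 - (2 * θ - 1) + κ := by linarith
        have hnn2 : 0 ≤ (1 - θ + κ / 2) * d := mul_nonneg (by linarith) hd0
        calc dist x x₁ ≤ _ := hxb
          _ ≤ (1 + η) * (1 - (2 * θ - 1) + κ) * ((1 + η) * (d / 2)) := by gcongr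
          _ = (1 + η) * (1 + η) * ((1 - θ + κ / 2) * d) := by ring
          _ ≤ (1 + δ) * ((1 - θ + κ / 2) * d) := by gcongr
          _ = _ := by ring

theorem IsApproxLength.exists_isIntermediatePoint (hD : IsApproxLength D) {x₀ x₁ : X}
    (hx₀ : x₀ ∈ D) (hx₁ : x₁ ∈ D) {θ ε : ℝ} (hθ : θ ∈ Ioo (0 : ℝ) 1) (hε : 0 < ε) :
    ∃ x ∈ D, IsIntermediatePoint dist θ ε x₀ x₁ x := by
  have hθ0 := hθ.1
  have hθ1 : 0 < 1 - θ := sub_pos.2 hθ.2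
  have hT : Tendsto (fun n : ℕ => (1 - θ) * ((1 + (1 / 2 : ℝ) ^ n) * (θ + (1 / 2) ^ n)) ^ 2 +
      θ * ((1 + (1 / 2 : ℝ) ^ n) * (1 - θ + (1 / 2) ^ n)) ^ 2) atTop
      (𝓝 ((1 - θ) * ((1 + 0) * (θ + 0)) ^ 2 + θ * ((1 + 0) * (1 - θ + 0)) ^ 2)) := by
    have hp : Tendsto (fun n : ℕ => (1 / 2 : ℝ) ^ n) atTop (𝓝 0) :=
      tendsto_pow_atTop_nhds_zero_of_lt_one (by norm_num) (by norm_num)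
    exact Tendsto.comp (g := fun κ : ℝ => (1 - θ) * ((1 + κ) * (θ + κ)) ^ 2 +
      θ * ((1 + κ) * (1 - θ + κ)) ^ 2) (Continuous.tendsto (by fun_prop) 0) hp
  obtain ⟨n, hn⟩ := (hT.eventually_lt_const
    (u := θ * (1 - θ) * (1 + ε ^ 2 * θ * (1 - θ))) (by
      have : 0 < θ * (1 - θ) * (ε ^ 2 * θ * (1 - θ)) := by positivity
      linarith)).exists
  obtain ⟨x, hx, ha, hb⟩ := hD.exists_dist_le n θ ⟨hθ0.le, hθ.2.le⟩ ((1 / 2) ^ n)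
    (by positivity) x₀ hx₀ x₁ hx₁
  refine ⟨x, hx, (isIntermediatePoint_iff hθ).2 ?_⟩
  calc (1 - θ) * dist x₀ x ^ 2 + θ * dist x x₁ ^ 2
      ≤ (1 - θ) * ((1 + (1 / 2) ^ n) * (θ + (1 / 2) ^ n) * dist x₀ x₁) ^ 2 +
        θ * ((1 + (1 / 2) ^ n) * (1 - θ + (1 / 2) ^ n) * dist x₀ x₁) ^ 2 := by gcongr
    _ = ((1 - θ) * ((1 + (1 / 2 : ℝ) ^ n) * (θ + (1 / 2) ^ n)) ^ 2 +
      θ * ((1 + (1 / 2 : ℝ) ^ n) * (1 - θ + (1 / 2) ^ n)) ^ 2) * dist x₀ x₁ ^ 2 := by ring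
    _ ≤ θ * (1 - θ) * (1 + ε ^ 2 * θ * (1 - θ)) * dist x₀ x₁ ^ 2 := by gcongr
    _ = _ := by ring

theorem IsGradientFlow.approxConvexIn (hbot : ∀ x, φ x ≠ ⊥) (hlsc : LowerSemicontinuous φ)
    (hS : IsGradientFlow φ lam D S) (hD : IsApproxLength D) : ApproxConvexIn dist φ lam D := by
  refine approxConvexIn_of_regularizing (S := S) (A := fun t => Real.exp (-(lam * t)))
    (B := fun t => expPrimitive lam t * Real.exp (-(lam * t))) hbot
    (fun _ _ _ _ => le_rfl) (fun x _ => dist_self x) (fun x _ y _ z _ => dist_triangle x y z)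
    (fun x _ y _ => dist_comm x y)
    (fun x hx => hS.exists_quadratic_lower_bound hbot hlsc hx)
    (fun v hv p hp t ht => ⟨⟨hS.mapsTo t ht.le hp, hS.mem_dom hp ht⟩,
      hS.sq_dist_le hbot hlsc hp ht hv.2⟩)
    (fun t _ => (Real.exp_pos _).le)
    (fun t ht => mul_pos (expPrimitive_pos lam ht) (Real.exp_pos _)) ?_ ?_
    (fun x₀ hx₀ x₁ hx₁ _ θ hθ ε hε => hD.exists_isIntermediatePoint hx₀ hx₁ hθ hε.1)
  · have hE := continuous_expPrimitive lam
    have : Tendsto (fun t : ℝ => expPrimitive lam t * Real.exp (-(lam * t))) (𝓝 0)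
        (𝓝 (expPrimitive lam 0 * Real.exp (-(lam * 0)))) :=
      Continuous.tendsto (by fun_prop) 0
    rw [expPrimitive_zero, zero_mul] at this
    exact this.mono_left nhdsWithin_le_nhds
  · refine tendsto_const_nhds.congr' ?_
    filter_upwards [self_mem_nhdsWithin] with t ht
    have hE := expPrimitive_pos lam (mem_Ioi.1 ht)
    rw [eq_div_iff (mul_pos hE (Real.exp_pos _)).ne', ← mul_assoc, mul_expPrimitive, sub_mul,
      ← Real.exp_add]
    simp

end EVI

/-! ### Absolute continuity by comparison -/

theorem AbsolutelyContinuousOnInterval.of_dist_le {Y Z : Type*} [PseudoMetricSpace Y]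
    [PseudoMetricSpace Z] {f : ℝ → Y} {g : ℝ → Z} {a b : ℝ}
    (hg : AbsolutelyContinuousOnInterval g a b)
    (h : ∀ s ∈ uIcc a b, ∀ t ∈ uIcc a b, dist (f s) (f t) ≤ dist (g s) (g t)) :
    AbsolutelyContinuousOnInterval f a b := by
  refine tendsto_of_tendsto_of_tendsto_of_le_of_le' tendsto_const_nhds hg
    (Eventually.of_forall fun E => Finset.sum_nonneg fun _ _ => dist_nonneg) ?_
  refine Eventually.filter_mono inf_le_right (eventually_principal.2 fun E hE => ?_)
  exact Finset.sum_le_sum fun i hi => h _ (hE.1 i hi).1 _ (hE.1 i hi).2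

/-! ### Lipschitz curves and reparametrization -/

namespace EVI

open scoped ENNReal

variable {X : Type*} [MetricSpace X]

/-- `γ` is `L`-Lipschitz on `[0, 1]` and connects `x₀` to `x₁`. -/
structure IsLipschitzCurve (L : ℝ) (x₀ x₁ : X) (γ : ℝ → X) : Prop where
  start : γ 0 = x₀
  finish : γ 1 = x₁
  dist_le : ∀ s ∈ Icc (0 : ℝ) 1, ∀ t ∈ Icc (0 : ℝ) 1, s ≤ t → dist (γ s) (γ t) ≤ L * (t - s)

namespace IsLipschitzCurve

variable {L : ℝ} {x₀ x₁ : X} {γ : ℝ → X}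

theorem dist_endpoints_le (h : IsLipschitzCurve L x₀ x₁ γ) : dist x₀ x₁ ≤ L := by
  have := h.dist_le 0 ⟨le_rfl, zero_le_one⟩ 1 ⟨zero_le_one, le_rfl⟩ zero_le_one
  rwa [h.start, h.finish, sub_zero, mul_one] at this

theorem nonneg (h : IsLipschitzCurve L x₀ x₁ γ) : 0 ≤ L := dist_nonneg.trans h.dist_endpoints_le

theorem dist_le_abs (h : IsLipschitzCurve L x₀ x₁ γ) {s t : ℝ} (hs : s ∈ Icc (0 : ℝ) 1)
    (ht : t ∈ Icc (0 : ℝ) 1) : dist (γ s) (γ t) ≤ L * |t - s| := by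
  rcases le_total s t with hst | hst
  · rw [abs_of_nonneg (sub_nonneg.2 hst)]; exact h.dist_le s hs t ht hst
  · rw [abs_of_nonpos (sub_nonpos.2 hst), neg_sub, dist_comm]; exact h.dist_le t ht s hs hst

theorem symm (h : IsLipschitzCurve L x₀ x₁ γ) :
    IsLipschitzCurve L x₁ x₀ (fun s => γ (1 - s)) where
  start := by simpa using h.finish
  finish := by simpa using h.start
  dist_le s hs t ht hst := by
    have := h.dist_le (1 - t) ⟨by linarith [ht.2], by linarith [ht.1]⟩ (1 - s)
      ⟨by linarith [hs.2], by linarith [hs.1]⟩ (by linarith)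
    rw [dist_comm]
    linarith

theorem restrict (h : IsLipschitzCurve L x₀ x₁ γ) {a b : ℝ} (ha : 0 ≤ a) (hab : a ≤ b)
    (hb : b ≤ 1) :
    IsLipschitzCurve ((b - a) * L) (γ a) (γ b) (fun s => γ (a + s * (b - a))) where
  start := by simp
  finish := by simp
  dist_le s hs t ht hst := by
    have hmem : ∀ r ∈ Icc (0 : ℝ) 1, a + r * (b - a) ∈ Icc (0 : ℝ) 1 := by
      intro r hr
      have h0 : 0 ≤ r * (b - a) := mul_nonneg hr.1 (sub_nonneg.2 hab)
      have h1 : r * (b - a) ≤ 1 * (b - a) := mul_le_mul_of_nonneg_right hr.2 (sub_nonneg.2 hab)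
      constructor <;> linarith
    have := h.dist_le _ (hmem s hs) _ (hmem t ht)
      (by have := mul_le_mul_of_nonneg_right hst (sub_nonneg.2 hab); linarith)
    linarith

theorem metricDeriv_le (h : IsLipschitzCurve L x₀ x₁ γ) {t : ℝ} (ht : t ∈ Ioo (0 : ℝ) 1) :
    metricDeriv γ t ≤ ENNReal.ofReal L := by
  refine limsup_le_of_le (h := ?_)
  have hT : Tendsto (fun h : ℝ => t + h) (𝓝[≠] 0) (𝓝 t) := by
    have : Tendsto (fun h : ℝ => t + h) (𝓝 0) (𝓝 (t + 0)) :=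
      Continuous.tendsto (by fun_prop) 0
    rw [add_zero] at this
    exact this.mono_left nhdsWithin_le_nhds
  filter_upwards [hT.eventually (Ioo_mem_nhds ht.1 ht.2), self_mem_nhdsWithin] with r hr hr0
  apply ENNReal.ofReal_le_ofReal
  have hr0' : 0 < |r| := abs_pos.2 hr0
  rw [div_le_iff₀ hr0', dist_comm]
  have := h.dist_le_abs (Ioo_subset_Icc_self ht) (Ioo_subset_Icc_self hr)
  rwa [add_sub_cancel_left] at this

theorem lengthDist_le (h : IsLipschitzCurve L x₀ x₁ γ) :
    lengthDist univ x₀ x₁ ≤ ENNReal.ofReal L := by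
  have hAC : IsACIn univ γ := by
    refine ⟨fun _ _ => mem_univ _, fun _ => L, integrableOn_const (by simp), ?_⟩
    intro s hs t ht hst
    have := h.dist_le s hs t ht hst
    rw [intervalIntegral.integral_const, smul_eq_mul]
    linarith
  refine (iInf₂_le γ ⟨hAC, h.start, h.finish⟩).trans ?_
  calc curveLength γ ≤ ∫⁻ _ in Ioo (0 : ℝ) 1, ENNReal.ofReal L :=
        setLIntegral_mono' measurableSet_Ioo fun t ht => h.metricDeriv_le ht
    _ = ENNReal.ofReal L := by simp

end IsLipschitzCurve

/-- Reparametrization: a continuous curve whose increments are controlled by those of a function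
`V` can be traversed at speed at most the total increment of `V`. -/
theorem exists_isLipschitzCurve_of_dist_le_sub {x : ℝ → X} {V : ℝ → ℝ}
    (hx : ContinuousOn x (Icc 0 1))
    (hV : ∀ s ∈ Icc (0 : ℝ) 1, ∀ t ∈ Icc (0 : ℝ) 1, s ≤ t → dist (x s) (x t) ≤ V t - V s) :
    ∃ γ, IsLipschitzCurve (V 1 - V 0) (x 0) (x 1) γ := by
  have h0m : (0 : ℝ) ∈ Icc (0 : ℝ) 1 := ⟨le_rfl, zero_le_one⟩
  have h1m : (1 : ℝ) ∈ Icc (0 : ℝ) 1 := ⟨zero_le_one, le_rfl⟩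
  have hmono : ∀ s ∈ Icc (0 : ℝ) 1, ∀ t ∈ Icc (0 : ℝ) 1, s ≤ t → V s ≤ V t :=
    fun s hs t ht hst => sub_nonneg.1 (dist_nonneg.trans (hV s hs t ht hst))
  set W := V 1 - V 0 with hW
  have hW0 : 0 ≤ W := sub_nonneg.2 (hmono 0 h0m 1 h1m zero_le_one)
  set A : ℝ → Set ℝ := fun τ => {s ∈ Icc (0 : ℝ) 1 | V s ≤ V 0 + τ * W} with hA
  -- A generalized inverse of `V`, normalized to `[0, 1]`. It may jump where `V` is constant, but
  -- there `x` is constant too.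
  set σ : ℝ → ℝ := fun τ => sSup (A τ) with hσ
  have hbdd : ∀ τ, BddAbove (A τ) := fun τ => ⟨1, fun s hs => hs.1.2⟩
  have hA0 : ∀ τ, 0 ≤ τ → (0 : ℝ) ∈ A τ := fun τ hτ =>
    ⟨h0m, le_add_of_nonneg_right (mul_nonneg hτ hW0)⟩
  have hσmem : ∀ τ, 0 ≤ τ → σ τ ∈ Icc (0 : ℝ) 1 := fun τ hτ =>
    ⟨le_csSup (hbdd τ) (hA0 τ hτ), csSup_le ⟨0, hA0 τ hτ⟩ fun s hs => hs.1.2⟩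
  have hσmono : ∀ τ τ', 0 ≤ τ → τ ≤ τ' → σ τ ≤ σ τ' := fun τ τ' hτ hττ =>
    csSup_le_csSup (hbdd τ') ⟨0, hA0 τ hτ⟩ fun s hs =>
      ⟨hs.1, hs.2.trans (by gcongr)⟩
  have hlow : ∀ τ, 0 ≤ τ → ∀ s ∈ Icc (0 : ℝ) 1, s < σ τ → V s ≤ V 0 + τ * W := by
    intro τ hτ s hs hsσ
    obtain ⟨r, hr, hsr⟩ := exists_lt_of_lt_csSup ⟨0, hA0 τ hτ⟩ hsσ
    exact (hmono s hs r hr.1 hsr.le).trans hr.2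
  have hupp : ∀ τ, ∀ s ∈ Icc (0 : ℝ) 1, σ τ < s → V 0 + τ * W ≤ V s := by
    intro τ s hs hsσ
    by_contra! hcon
    exact absurd (le_csSup (hbdd τ) (⟨hs, hcon.le⟩ : s ∈ A τ)) (not_le.2 hsσ)
  -- `V` need not be continuous, so its level is controlled only strictly between two values of `σ`;
  -- continuity of `x` carries the bound to the endpoints.
  have hcont : ∀ s ∈ Icc (0 : ℝ) 1, ∀ t ∈ Icc (0 : ℝ) 1, s < t → ∀ c : ℝ,
      (∀ s' ∈ Ioo s t, ∀ t' ∈ Ioo s t, s' < t' → dist (x s') (x t') ≤ c) →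
      dist (x s) (x t) ≤ c := by
    intro s hs t ht hst c hc
    have hsub : Ioo s t ⊆ Icc (0 : ℝ) 1 := fun r hr => ⟨hs.1.trans hr.1.le, hr.2.le.trans ht.2⟩
    have hm1 : Tendsto x (𝓝[>] s) (𝓝 (x s)) := by
      have := (hx s hs).mono hsub
      rwa [ContinuousWithinAt, nhdsWithin_Ioo_eq_nhdsGT hst] at this
    have hm2 : Tendsto x (𝓝[<] t) (𝓝 (x t)) := by
      have := (hx t ht).mono hsub
      rwa [ContinuousWithinAt, nhdsWithin_Ioo_eq_nhdsLT hst] at this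
    have hlim1 : ∀ t' ∈ Ioo s t, dist (x s) (x t') ≤ c := by
      intro t' ht'
      refine le_of_tendsto (hm1.dist tendsto_const_nhds) ?_
      filter_upwards [Ioo_mem_nhdsGT ht'.1] with s' hs'
      exact hc s' ⟨hs'.1, hs'.2.trans ht'.2⟩ t' ht' hs'.2
    refine le_of_tendsto (tendsto_const_nhds.dist hm2) ?_
    filter_upwards [Ioo_mem_nhdsLT hst] with t' ht' using hlim1 t' ht'
  have hσ1 : σ 1 = 1 := by
    refine le_antisymm (hσmem 1 zero_le_one).2 (le_csSup (hbdd 1) ⟨h1m, ?_⟩)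
    rw [hW]; linarith
  have hσ0 : x (σ 0) = x 0 := by
    rcases (hσmem 0 le_rfl).1.eq_or_lt with h | h
    · rw [← h]
    · refine (dist_le_zero.1 (hcont 0 h0m (σ 0) (hσmem 0 le_rfl) h 0 ?_)).symm
      intro s' hs' t' ht' hst
      have hm : ∀ r ∈ Ioo 0 (σ 0), r ∈ Icc (0 : ℝ) 1 := fun r hr =>
        ⟨hr.1.le, hr.2.le.trans (hσmem 0 le_rfl).2⟩
      have h1 := hV s' (hm s' hs') t' (hm t' ht') hst.le
      have h2 := hlow 0 le_rfl t' (hm t' ht') ht'.2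
      have h3 := hmono 0 h0m s' (hm s' hs') hs'.1.le
      linarith
  refine ⟨fun τ => x (σ τ), hσ0, by rw [hσ1], ?_⟩
  intro τ hτ τ' hτ' hττ
  have hnn : 0 ≤ W * (τ' - τ) := mul_nonneg hW0 (sub_nonneg.2 hττ)
  rcases (hσmono τ τ' hτ.1 hττ).eq_or_lt with h | h
  · simpa only [h, dist_self] using hnn
  · refine hcont _ (hσmem τ hτ.1) _ (hσmem τ' hτ'.1) h _ ?_
    intro s' hs' t' ht' hst
    have hm : ∀ r ∈ Ioo (σ τ) (σ τ'), r ∈ Icc (0 : ℝ) 1 := fun r hr =>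
      ⟨(hσmem τ hτ.1).1.trans hr.1.le, hr.2.le.trans (hσmem τ' hτ'.1).2⟩
    have h1 := hV s' (hm s' hs') t' (hm t' ht') hst.le
    have h2 := hlow τ' hτ'.1 t' (hm t' ht') ht'.2
    have h3 := hupp τ s' (hm s' hs') hs'.1
    linarith

/-- Traversing each curve in half the time gives a poor Lipschitz constant; reparametrizing by the
accumulated length `V` restores `L₁ + L₂`. -/
theorem IsLipschitzCurve.exists_trans {L₁ L₂ : ℝ} {x₀ x₁ x₂ : X} {γ₁ γ₂ : ℝ → X}
    (h₁ : IsLipschitzCurve L₁ x₀ x₁ γ₁) (h₂ : IsLipschitzCurve L₂ x₁ x₂ γ₂) :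
    ∃ γ, IsLipschitzCurve (L₁ + L₂) x₀ x₂ γ := by
  have hL₁ := h₁.nonneg
  have hL₂ := h₂.nonneg
  set x : ℝ → X := fun s => if s ≤ 1 / 2 then γ₁ (2 * s) else γ₂ (2 * s - 1) with hx
  set V : ℝ → ℝ := fun s => if s ≤ 1 / 2 then L₁ * (2 * s) else L₁ + L₂ * (2 * s - 1) with hV
  have key : ∀ s ∈ Icc (0 : ℝ) 1, ∀ t ∈ Icc (0 : ℝ) 1, s ≤ t →
      dist (x s) (x t) ≤ V t - V s := by
    intro s hs t ht hst
    by_cases ht2 : t ≤ 1 / 2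
    · have hs2 : s ≤ 1 / 2 := hst.trans ht2
      simp only [hx, hV, if_pos ht2, if_pos hs2]
      have := h₁.dist_le (2 * s) ⟨by linarith [hs.1], by linarith⟩ (2 * t)
        ⟨by linarith [ht.1], by linarith⟩ (by linarith)
      linarith
    · have htm : 2 * t - 1 ∈ Icc (0 : ℝ) 1 := ⟨by linarith, by linarith [ht.2]⟩
      by_cases hs2 : s ≤ 1 / 2
      · simp only [hx, hV, if_neg ht2, if_pos hs2]
        have e1 := h₁.dist_le (2 * s) ⟨by linarith [hs.1], by linarith⟩ 1
          ⟨zero_le_one, le_rfl⟩ (by linarith)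
        have e2 := h₂.dist_le 0 ⟨le_rfl, zero_le_one⟩ (2 * t - 1) htm htm.1
        rw [h₁.finish] at e1
        rw [h₂.start] at e2
        have := dist_triangle (γ₁ (2 * s)) x₁ (γ₂ (2 * t - 1))
        linarith
      · simp only [hx, hV, if_neg ht2, if_neg hs2]
        have := h₂.dist_le (2 * s - 1) ⟨by linarith, by linarith [hs.2]⟩ (2 * t - 1) htm
          (by linarith)
        linarith
  have hVle : ∀ s t : ℝ, s ≤ t → V t - V s ≤ 2 * (L₁ + L₂) * (t - s) := by
    intro s t hst
    have e1 : 0 ≤ L₁ * (t - s) := mul_nonneg hL₁ (sub_nonneg.2 hst)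
    have e2 : 0 ≤ L₂ * (t - s) := mul_nonneg hL₂ (sub_nonneg.2 hst)
    by_cases ht2 : t ≤ 1 / 2
    · have hs2 : s ≤ 1 / 2 := hst.trans ht2
      simp only [hV, if_pos ht2, if_pos hs2]
      linarith
    · push Not at ht2
      by_cases hs2 : s ≤ 1 / 2
      · simp only [hV, if_neg (not_le.2 ht2), if_pos hs2]
        have e3 : 0 ≤ L₁ * (t - 1 / 2) := mul_nonneg hL₁ (by linarith)
        have e4 : 0 ≤ L₂ * (1 / 2 - s) := mul_nonneg hL₂ (by linarith)
        linarith
      · simp only [hV, if_neg (not_le.2 ht2), if_neg hs2]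
        linarith
  have hLip : LipschitzOnWith (Real.toNNReal (2 * (L₁ + L₂))) x (Icc 0 1) := by
    refine LipschitzOnWith.of_dist_le_mul fun s hs t ht => ?_
    rw [Real.coe_toNNReal _ (by positivity)]
    rcases le_total s t with hst | hst
    · rw [Real.dist_eq, abs_sub_comm, abs_of_nonneg (sub_nonneg.2 hst)]
      exact (key s hs t ht hst).trans (hVle s t hst)
    · rw [Real.dist_eq, abs_of_nonneg (sub_nonneg.2 hst), dist_comm]
      exact (key t ht s hs hst).trans (hVle t s hst)
  obtain ⟨γ, hγ⟩ := exists_isLipschitzCurve_of_dist_le_sub hLip.continuousOn key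
  refine ⟨γ, ?_⟩
  have hV0 : V 0 = 0 := by simp [hV]
  have hV1 : V 1 = L₁ + L₂ := by norm_num [hV]
  have hx0 : x 0 = x₀ := by simp [hx, h₁.start]
  have hx1 : x 1 = x₂ := by norm_num [hx, h₂.finish]
  rwa [hV0, hV1, hx0, hx1, sub_zero] at hγ

/-! ### Absolutely continuous curves -/

theorem IsACIn.exists_absolutelyContinuous_dist_le {D : Set X} {x : ℝ → X} (h : IsACIn D x) :
    ∃ g : ℝ → ℝ, AbsolutelyContinuousOnInterval g 0 1 ∧
      ∀ s ∈ Icc (0 : ℝ) 1, ∀ t ∈ Icc (0 : ℝ) 1, dist (x s) (x t) ≤ dist (g s) (g t) := by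
  obtain ⟨-, m, hm, hd⟩ := h
  have hint : IntervalIntegrable m volume 0 1 :=
    (intervalIntegrable_iff_integrableOn_Icc_of_le zero_le_one).2 hm
  refine ⟨_, hint.absolutelyContinuousOnInterval_intervalIntegral left_mem_uIcc, ?_⟩
  have key : ∀ s ∈ Icc (0 : ℝ) 1, ∀ t ∈ Icc (0 : ℝ) 1, s ≤ t →
      dist (x s) (x t) ≤ dist (∫ v in (0 : ℝ)..s, m v) (∫ v in (0 : ℝ)..t, m v) := by
    intro s hs t ht hst
    have hsub : ∀ r ∈ Icc (0 : ℝ) 1, IntervalIntegrable m volume 0 r := fun r hr =>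
      hint.mono_set (by
        rw [uIcc_of_le zero_le_one, uIcc_of_le hr.1]
        exact Icc_subset_Icc_right hr.2)
    rw [dist_comm (∫ v in (0 : ℝ)..s, m v), Real.dist_eq,
      intervalIntegral.integral_interval_sub_left (hsub t ht) (hsub s hs)]
    exact (hd s hs t ht hst).trans (le_abs_self _)
  intro s hs t ht
  rcases le_total s t with hst | hst
  · exact key s hs t ht hst
  · rw [dist_comm, dist_comm (∫ v in (0 : ℝ)..s, m v)]
    exact key t ht s hs hst

theorem IsACIn.absolutelyContinuousOnInterval {D : Set X} {x : ℝ → X} (h : IsACIn D x) :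
    AbsolutelyContinuousOnInterval x 0 1 := by
  obtain ⟨g, hg, hd⟩ := h.exists_absolutelyContinuous_dist_le
  refine hg.of_dist_le ?_
  rwa [uIcc_of_le zero_le_one]

theorem IsACIn.continuousOn {D : Set X} {x : ℝ → X} (h : IsACIn D x) :
    ContinuousOn x (Icc 0 1) := by
  obtain ⟨g, hg, hd⟩ := h.exists_absolutelyContinuous_dist_le
  have hgc : ContinuousOn g (uIcc 0 1) := AbsolutelyContinuousOnInterval.continuousOn hg
  rw [uIcc_of_le zero_le_one] at hgc
  intro t ht
  refine tendsto_iff_dist_tendsto_zero.2 ?_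
  refine squeeze_zero' (Eventually.of_forall fun _ => dist_nonneg) ?_
    (tendsto_iff_dist_tendsto_zero.1 (hgc t ht))
  filter_upwards [self_mem_nhdsWithin] with s hs using hd s hs t ht

theorem enorm_deriv_dist_le_metricDeriv (x : ℝ → X) (z : X) (t : ℝ) :
    ‖deriv (fun s => dist (x s) z) t‖ₑ ≤ metricDeriv x t := by
  by_cases hdiff : DifferentiableAt ℝ (fun s => dist (x s) z) t
  · have hT := (hasDerivAt_iff_tendsto_slope_zero.1 hdiff.hasDerivAt).enorm
    rw [← hT.limsup_eq]
    refine limsup_le_limsup ?_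
    filter_upwards [self_mem_nhdsWithin] with h hh
    rw [Real.enorm_eq_ofReal_abs]
    apply ENNReal.ofReal_le_ofReal
    rw [smul_eq_mul, abs_mul, abs_inv, div_eq_inv_mul]
    gcongr
    exact abs_dist_sub_le _ _ _
  · rw [deriv_zero_of_not_differentiableAt hdiff]
    simp

/-- The real function `r ↦ d(x r, x s)` is absolutely continuous and its derivative is dominated by
the metric derivative, so the fundamental theorem of calculus applies without existence of the
metric derivative as a limit. -/
theorem IsACIn.ofReal_dist_le_lintegral_metricDeriv {D : Set X} {x : ℝ → X} (h : IsACIn D x)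
    {s t : ℝ} (hs : 0 ≤ s) (hst : s ≤ t) (ht : t ≤ 1) :
    ENNReal.ofReal (dist (x s) (x t)) ≤ ∫⁻ r in Ioo s t, metricDeriv x r := by
  have hAC : AbsolutelyContinuousOnInterval (fun r => dist (x r) (x s)) s t := by
    refine (h.absolutelyContinuousOnInterval.of_dist_le fun a _ b _ => ?_).mono
      (c := s) (d := t) ?_
    · exact dist_dist_dist_le_left _ _ _
    · rw [uIcc_of_le zero_le_one, uIcc_of_le hst]
      exact Icc_subset_Icc hs ht
  have hint := hAC.integral_deriv_eq_sub
  simp only [dist_self, sub_zero] at hint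
  rw [dist_comm, ← hint, intervalIntegral.integral_of_le hst, integral_Ioc_eq_integral_Ioo]
  calc _ ≤ ‖∫ r in Ioo s t, deriv (fun r => dist (x r) (x s)) r‖ₑ :=
        by rw [Real.enorm_eq_ofReal_abs]; exact ENNReal.ofReal_le_ofReal (le_abs_self _)
    _ ≤ ∫⁻ r in Ioo s t, ‖deriv (fun r => dist (x r) (x s)) r‖ₑ :=
        enorm_integral_le_lintegral_enorm _
    _ ≤ _ := lintegral_mono fun r => enorm_deriv_dist_le_metricDeriv x (x s) r

/-- Reparametrization by the accumulated length. Only superadditivity of the integral over adjacent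
intervals is needed. -/
theorem IsACIn.exists_isLipschitzCurve {D : Set X} {x : ℝ → X} (h : IsACIn D x)
    (hfin : curveLength x ≠ ∞) :
    ∃ γ, IsLipschitzCurve (curveLength x).toReal (x 0) (x 1) γ := by
  have hcont := h.continuousOn
  have hfin' : ∀ t ∈ Icc (0 : ℝ) 1, ∫⁻ r in Ioo 0 t, metricDeriv x r ≠ ∞ := fun t ht =>
    ne_top_of_le_ne_top hfin (lintegral_mono_set (Ioo_subset_Ioo_right ht.2))
  set V : ℝ → ℝ := fun t => (∫⁻ r in Ioo 0 t, metricDeriv x r).toReal with hVdef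
  have hV : ∀ s ∈ Icc (0 : ℝ) 1, ∀ t ∈ Icc (0 : ℝ) 1, s ≤ t →
      dist (x s) (x t) ≤ V t - V s := by
    intro s hs t ht hst
    have h1 : (∫⁻ r in Ioo 0 s, metricDeriv x r) + ∫⁻ r in Ioo s t, metricDeriv x r
        ≤ ∫⁻ r in Ioo 0 t, metricDeriv x r := by
      rw [← lintegral_union measurableSet_Ioo
        (disjoint_left.2 fun r hr hr' => lt_asymm hr.2 hr'.1)]
      exact lintegral_mono_set (union_subset (Ioo_subset_Ioo_right hst)
        (Ioo_subset_Ioo_left hs.1))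
    have h2 := h.ofReal_dist_le_lintegral_metricDeriv hs.1 hst ht.2
    have h3 := (add_le_add (le_refl (∫⁻ r in Ioo 0 s, metricDeriv x r)) h2).trans h1
    have h4 := ENNReal.toReal_mono (hfin' t ht) h3
    rw [ENNReal.toReal_add (hfin' s hs) ENNReal.ofReal_ne_top,
      ENNReal.toReal_ofReal dist_nonneg] at h4
    exact le_sub_iff_add_le'.2 h4
  obtain ⟨γ, hγ⟩ := exists_isLipschitzCurve_of_dist_le_sub hcont hV
  have hV0 : V 0 = 0 := by simp [hVdef]
  have hV1 : V 1 = (curveLength x).toReal := rfl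
  rw [hV0, hV1, sub_zero] at hγ
  exact ⟨γ, hγ⟩

/-! ### The length distance -/

theorem lengthDist_lt_ofReal_iff {x₀ x₁ : X} {r : ℝ} :
    lengthDist univ x₀ x₁ < ENNReal.ofReal r ↔ ∃ L < r, ∃ γ, IsLipschitzCurve L x₀ x₁ γ := by
  constructor
  · intro h
    rw [lengthDist] at h
    simp only [iInf_lt_iff] at h
    obtain ⟨x, ⟨hAC, h0, h1⟩, hlt⟩ := h
    obtain ⟨γ, hγ⟩ := hAC.exists_isLipschitzCurve hlt.ne_top
    rw [h0, h1] at hγ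
    exact ⟨_, (ENNReal.lt_ofReal_iff_toReal_lt hlt.ne_top).1 hlt, γ, hγ⟩
  · rintro ⟨L, hLr, γ, hγ⟩
    exact hγ.lengthDist_le.trans_lt
      ((ENNReal.ofReal_lt_ofReal_iff (hγ.nonneg.trans_lt hLr)).2 hLr)

theorem exists_isLipschitzCurve_of_toReal_lt {x₀ x₁ : X} (hfin : lengthDist univ x₀ x₁ < ∞)
    {r : ℝ} (h : (lengthDist univ x₀ x₁).toReal < r) :
    ∃ L < r, ∃ γ, IsLipschitzCurve L x₀ x₁ γ :=
  lengthDist_lt_ofReal_iff.1 ((ENNReal.lt_ofReal_iff_toReal_lt hfin.ne).2 h)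

theorem IsLipschitzCurve.toReal_lengthDist_le {L : ℝ} {x₀ x₁ : X} {γ : ℝ → X}
    (h : IsLipschitzCurve L x₀ x₁ γ) : (lengthDist univ x₀ x₁).toReal ≤ L := by
  have := ENNReal.toReal_mono ENNReal.ofReal_ne_top h.lengthDist_le
  rwa [ENNReal.toReal_ofReal h.nonneg] at this

theorem IsLipschitzCurve.lengthDist_lt_top {L : ℝ} {x₀ x₁ : X} {γ : ℝ → X}
    (h : IsLipschitzCurve L x₀ x₁ γ) : lengthDist univ x₀ x₁ < ∞ :=
  h.lengthDist_le.trans_lt ENNReal.ofReal_lt_top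

theorem exists_isLipschitzCurve_of_lt_top {x₀ x₁ : X} (hfin : lengthDist univ x₀ x₁ < ∞) :
    ∃ L γ, IsLipschitzCurve L x₀ x₁ γ := by
  obtain ⟨L, -, γ, h⟩ := exists_isLipschitzCurve_of_toReal_lt hfin (lt_add_one _)
  exact ⟨L, γ, h⟩

theorem lengthDist_self (x : X) : lengthDist univ x x = 0 := by
  have h : IsLipschitzCurve 0 x x (fun _ => x) := ⟨rfl, rfl, by simp⟩
  simpa using h.lengthDist_le

theorem lengthDist_comm (x y : X) : lengthDist univ x y = lengthDist univ y x := by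
  have key : ∀ x y : X, lengthDist univ x y ≤ lengthDist univ y x := by
    intro x y
    rcases eq_top_or_lt_top (lengthDist univ y x) with h | h
    · rw [h]; exact le_top
    rw [← ENNReal.ofReal_toReal h.ne]
    refine ENNReal.le_of_forall_pos_le_add fun ε hε _ => ?_
    obtain ⟨L, hL, γ, hγ⟩ := exists_isLipschitzCurve_of_toReal_lt h
      (lt_add_of_pos_right _ (NNReal.coe_pos.2 hε))
    refine hγ.symm.lengthDist_le.trans ?_
    rw [← ENNReal.ofReal_coe_nnreal, ← ENNReal.ofReal_add ENNReal.toReal_nonneg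
      (NNReal.coe_nonneg ε)]
    exact ENNReal.ofReal_le_ofReal hL.le
  exact le_antisymm (key x y) (key y x)

theorem lengthDist_lt_top_trans {x y z : X} (hxy : lengthDist univ x y < ∞)
    (hyz : lengthDist univ y z < ∞) : lengthDist univ x z < ∞ := by
  obtain ⟨L₁, γ₁, h₁⟩ := exists_isLipschitzCurve_of_lt_top hxy
  obtain ⟨L₂, γ₂, h₂⟩ := exists_isLipschitzCurve_of_lt_top hyz
  obtain ⟨γ, h⟩ := h₁.exists_trans h₂
  exact h.lengthDist_lt_top

theorem toReal_lengthDist_triangle {x y z : X} (hxy : lengthDist univ x y < ∞)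
    (hyz : lengthDist univ y z < ∞) : (lengthDist univ x z).toReal ≤
      (lengthDist univ x y).toReal + (lengthDist univ y z).toReal := by
  refine le_of_forall_pos_le_add fun ε hε => ?_
  obtain ⟨L₁, hL₁, γ₁, h₁⟩ := exists_isLipschitzCurve_of_toReal_lt hxy
    (lt_add_of_pos_right _ (half_pos hε))
  obtain ⟨L₂, hL₂, γ₂, h₂⟩ := exists_isLipschitzCurve_of_toReal_lt hyz
    (lt_add_of_pos_right _ (half_pos hε))
  obtain ⟨γ, h⟩ := h₁.exists_trans h₂
  linarith [h.toReal_lengthDist_le]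

theorem dist_le_toReal_lengthDist {x y : X} (hxy : lengthDist univ x y < ∞) :
    dist x y ≤ (lengthDist univ x y).toReal := by
  refine le_of_forall_pos_le_add fun ε hε => ?_
  obtain ⟨L, hL, γ, h⟩ := exists_isLipschitzCurve_of_toReal_lt hxy (lt_add_of_pos_right _ hε)
  exact h.dist_endpoints_le.trans hL.le

theorem lengthDist_lt_top_of_mem_lengthClass {a x y : X} (hx : x ∈ lengthClass univ a)
    (hy : y ∈ lengthClass univ a) : lengthDist univ x y < ∞ := by
  refine lengthDist_lt_top_trans hx.2 ?_
  rw [lengthDist_comm]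
  exact hy.2

/-- Evaluate a nearly shortest Lipschitz curve at time `θ`. Positivity of the distance leaves room
for a constant below `d √(1 + ε²θ(1-θ))`. -/
theorem exists_isIntermediatePoint_lengthDist {a x₀ x₁ : X} (hx₀ : x₀ ∈ lengthClass univ a)
    (hx₁ : x₁ ∈ lengthClass univ a) (hpos : 0 < (lengthDist univ x₀ x₁).toReal) {θ ε : ℝ}
    (hθ : θ ∈ Ioo (0 : ℝ) 1) (hε : 0 < ε) :
    ∃ x ∈ lengthClass univ a,
      IsIntermediatePoint (fun x y => (lengthDist univ x y).toReal) θ ε x₀ x₁ x := by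
  have hθ0 := hθ.1
  have hθ1 : 0 < 1 - θ := sub_pos.2 hθ.2
  set d := (lengthDist univ x₀ x₁).toReal with hd
  set κ := ε ^ 2 * θ * (1 - θ) with hκ
  have hκ0 : 0 < κ := by positivity
  have hlt : d < d * √(1 + κ) := by
    refine lt_mul_of_one_lt_right hpos ?_
    rw [Real.lt_sqrt zero_le_one]
    linarith
  obtain ⟨L, hL, γ, hγ⟩ := exists_isLipschitzCurve_of_toReal_lt
    (lengthDist_lt_top_of_mem_lengthClass hx₀ hx₁) hlt
  have hL0 := hγ.nonneg
  have h1 := hγ.restrict le_rfl hθ0.le hθ.2.le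
  have h2 := hγ.restrict hθ0.le hθ.2.le le_rfl
  rw [hγ.start, sub_zero] at h1
  rw [hγ.finish] at h2
  refine ⟨γ θ, ⟨mem_univ _, lengthDist_lt_top_trans h2.lengthDist_lt_top hx₁.2⟩, ?_⟩
  rw [isIntermediatePoint_iff hθ]
  have hL2 : L ^ 2 ≤ d ^ 2 * (1 + κ) := by
    calc L ^ 2 ≤ (d * √(1 + κ)) ^ 2 := by gcongr
      _ = d ^ 2 * (1 + κ) := by rw [mul_pow, Real.sq_sqrt (by positivity)]
  calc (1 - θ) * (lengthDist univ x₀ (γ θ)).toReal ^ 2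
        + θ * (lengthDist univ (γ θ) x₁).toReal ^ 2
      ≤ (1 - θ) * (θ * L) ^ 2 + θ * ((1 - θ) * L) ^ 2 := by
        gcongr
        · exact h1.toReal_lengthDist_le
        · exact h2.toReal_lengthDist_le
    _ = θ * (1 - θ) * L ^ 2 := by ring
    _ ≤ θ * (1 - θ) * (d ^ 2 * (1 + κ)) := by gcongr
    _ = _ := by ring

end EVI

namespace EVI

open scoped ENNReal

/-! ### Length estimates from local estimates -/

theorem dist_le_sub_of_locally {Y : Type*} [PseudoMetricSpace Y] {w : ℝ → Y} {V : ℝ → ℝ} {δ : ℝ}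
    (hδ : 0 < δ) (h : ∀ s ∈ Icc (0 : ℝ) 1, ∀ t ∈ Icc (0 : ℝ) 1, s < t → t - s < δ →
      dist (w s) (w t) ≤ V t - V s) :
    ∀ s ∈ Icc (0 : ℝ) 1, ∀ t ∈ Icc (0 : ℝ) 1, s ≤ t → dist (w s) (w t) ≤ V t - V s := by
  intro s hs t ht hst
  rcases hst.eq_or_lt with rfl | hst
  · simp
  obtain ⟨N, hN⟩ := exists_nat_gt ((t - s) / δ)
  have hts : 0 < t - s := sub_pos.2 hst
  have hN0 : (0 : ℝ) < N := lt_trans (by positivity) hN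
  set k := (t - s) / N with hk
  have hk0 : 0 < k := by positivity
  have hkδ : k < δ := by
    rw [hk, div_lt_iff₀ hN0]
    rwa [div_lt_iff₀ hδ, mul_comm] at hN
  have hNk : N * k = t - s := by rw [hk]; field_simp
  have ind : ∀ i : ℕ, i ≤ N → dist (w s) (w (s + i * k)) ≤ V (s + i * k) - V s := by
    intro i
    induction i with
    | zero => intro _; simp
    | succ i ih =>
      intro hi
      have hi' : (i : ℝ) + 1 ≤ N := by exact_mod_cast hi
      have hik : ((i : ℝ) + 1) * k ≤ t - s := by
        rw [← hNk]; exact mul_le_mul_of_nonneg_right hi' hk0.le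
      have hi0 : 0 ≤ (i : ℝ) * k := by positivity
      have h1 := ih (by omega)
      have h2 := h (s + i * k) ⟨by linarith [hs.1], by linarith [ht.2]⟩ (s + (i + 1 : ℕ) * k)
        ⟨by push_cast; linarith [hs.1], by push_cast; linarith [ht.2]⟩
        (by push_cast; linarith) (by push_cast; linarith)
      have h3 := dist_triangle (w s) (w (s + i * k)) (w (s + (i + 1 : ℕ) * k))
      linarith
  have hfin := ind N le_rfl
  rwa [hNk, add_sub_cancel] at hfin

variable {X : Type*} [MetricSpace X]

/-- An action bound: `H` plays the role of accumulated kinetic energy, and squared length on the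
unit interval is at most the action. -/
theorem lengthDist_le_of_sq_dist_le_mul {w : ℝ → X} {H : ℝ → ℝ} {δ : ℝ} (hδ : 0 < δ)
    (h : ∀ s ∈ Icc (0 : ℝ) 1, ∀ t ∈ Icc (0 : ℝ) 1, s < t → t - s < δ →
      dist (w s) (w t) ^ 2 ≤ (t - s) * (H t - H s)) :
    lengthDist univ (w 0) (w 1) < ∞ ∧
      (lengthDist univ (w 0) (w 1)).toReal ^ 2 ≤ H 1 - H 0 := by
  have h0m : (0 : ℝ) ∈ Icc (0 : ℝ) 1 := ⟨le_rfl, zero_le_one⟩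
  have h1m : (1 : ℝ) ∈ Icc (0 : ℝ) 1 := ⟨zero_le_one, le_rfl⟩
  have hinc : ∀ s ∈ Icc (0 : ℝ) 1, ∀ t ∈ Icc (0 : ℝ) 1, s < t → t - s < δ → 0 ≤ H t - H s :=
    fun s hs t ht hst hd => nonneg_of_mul_nonneg_right ((sq_nonneg _).trans (h s hs t ht hst hd))
      (sub_pos.2 hst)
  have hmono : ∀ s ∈ Icc (0 : ℝ) 1, ∀ t ∈ Icc (0 : ℝ) 1, s ≤ t → 0 ≤ H t - H s := by
    simpa using dist_le_sub_of_locally (w := fun _ => (0 : ℝ)) hδ (by simpa using hinc)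
  set E := H 1 - H 0 with hE
  have hE0 : 0 ≤ E := hmono 0 h0m 1 h1m zero_le_one
  have hcont : ContinuousOn w (Icc 0 1) := by
    have hbd : ∀ s ∈ Icc (0 : ℝ) 1, ∀ t ∈ Icc (0 : ℝ) 1, s < t → t - s < δ →
        dist (w s) (w t) ≤ √(|t - s| * E) := by
      intro s hs t ht hst hd
      apply Real.le_sqrt_of_sq_le
      rw [abs_of_pos (sub_pos.2 hst)]
      refine (h s hs t ht hst hd).trans (mul_le_mul_of_nonneg_left ?_ (sub_nonneg.2 hst.le))
      linarith [hmono 0 h0m s hs hs.1, hmono t ht 1 h1m ht.2]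
    intro t ht
    refine tendsto_iff_dist_tendsto_zero.2 ?_
    have hT : Tendsto (fun s : ℝ => √(|t - s| * E)) (𝓝[Icc 0 1] t) (𝓝 0) := by
      have : Tendsto (fun s : ℝ => √(|t - s| * E)) (𝓝 t) (𝓝 (√(|t - t| * E))) :=
        Continuous.tendsto (by fun_prop) t
      rw [sub_self, abs_zero, zero_mul, Real.sqrt_zero] at this
      exact this.mono_left nhdsWithin_le_nhds
    refine squeeze_zero' (Eventually.of_forall fun _ => dist_nonneg) ?_ hT
    filter_upwards [self_mem_nhdsWithin, nhdsWithin_le_nhds (Metric.ball_mem_nhds t hδ)]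
      with s hs hsb
    rw [Metric.mem_ball, Real.dist_eq] at hsb
    rcases lt_trichotomy s t with hst | rfl | hst
    · exact hbd s hs t ht hst (by rw [abs_sub_comm] at hsb; exact (le_abs_self _).trans_lt hsb)
    · simp
    · rw [dist_comm, abs_sub_comm]
      exact hbd t ht s hs hst ((le_abs_self _).trans_lt hsb)
  have key : ∀ η > 0, ∃ L ≤ √(E + η), ∃ γ, IsLipschitzCurve L (w 0) (w 1) γ := by
    intro η hη
    set κ := √(E + η) with hκ
    have hκ0 : 0 < κ := Real.sqrt_pos.2 (by positivity)
    have hκ2 : κ ^ 2 = E + η := Real.sq_sqrt (by positivity)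
    -- By the arithmetic–geometric mean inequality the increments of `V` dominate `√((t - s)(H t - H
    -- s))`. This `κ` is nearly optimal, and the slack `η` keeps it positive.
    set V : ℝ → ℝ := fun s => (κ * s + H s / κ) / 2 with hV
    have hloc : ∀ s ∈ Icc (0 : ℝ) 1, ∀ t ∈ Icc (0 : ℝ) 1, s < t → t - s < δ →
        dist (w s) (w t) ≤ V t - V s := by
      intro s hs t ht hst hd
      have hVd : V t - V s = (κ * (t - s) + (H t - H s) / κ) / 2 := by
        simp only [hV]; ring
      have hHn := hinc s hs t ht hst hd
      have hts := sub_pos.2 hst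
      rw [hVd]
      apply le_of_sq_le_sq _ (by positivity)
      refine (h s hs t ht hst hd).trans ?_
      have hprod : κ * (t - s) * ((H t - H s) / κ) = (t - s) * (H t - H s) := by field_simp
      nlinarith [sq_nonneg (κ * (t - s) - (H t - H s) / κ)]
    obtain ⟨γ, hγ⟩ := exists_isLipschitzCurve_of_dist_le_sub hcont
      (dist_le_sub_of_locally hδ hloc)
    refine ⟨_, ?_, γ, hγ⟩
    have hV1 : V 1 - V 0 = (κ + E / κ) / 2 := by simp only [hV, hE]; ring
    have hEκ : E / κ ≤ κ := by
      rw [div_le_iff₀ hκ0]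
      nlinarith
    rw [hV1]
    linarith
  constructor
  · obtain ⟨L, -, γ, hγ⟩ := key 1 one_pos
    exact hγ.lengthDist_lt_top
  · refine le_of_forall_pos_le_add fun η hη => ?_
    obtain ⟨L, hL, γ, hγ⟩ := key η hη
    rw [← Real.sq_sqrt (by positivity : 0 ≤ E + η)]
    exact pow_le_pow_left₀ ENNReal.toReal_nonneg (hγ.toReal_lengthDist_le.trans hL) 2

/-! ### The flow in the length distance -/

variable {φ : X → EReal} {lam : ℝ} {S : ℝ → X → X}

theorem exp_mul_le_of_mem_Icc (a : ℝ) {s : ℝ} (hs : s ∈ Icc (0 : ℝ) 1) :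
    Real.exp (s * a) ≤ 1 + s * (Real.exp a - 1) := by
  have := convexOn_exp.2 (mem_univ 0) (mem_univ a) (sub_nonneg.2 hs.2) hs.1 (by ring)
  simp only [smul_eq_mul, mul_zero, zero_add, Real.exp_zero, mul_one] at this
  linarith

/-- Go from `S (a t) (γ a)` to `S (b t) (γ b)` through `S (a t) (γ b)`: contraction handles the
first comparison, the integrated inequality over time `t (b - a)` the second. The factor `e^{-2λat}`
is replaced by its chord in `a`, whose integral over `[0, 1]` is `(1 + e^{-2λt})/2`. -/
theorem IsGradientFlow.sq_dist_flow_curve_le (hbot : ∀ x, φ x ≠ ⊥) (hlsc : LowerSemicontinuous φ)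
    (hS : IsGradientFlow φ lam univ S) {v p : X} (hv : v ∈ dom φ) {L : ℝ} {γ : ℝ → X}
    (hγ : IsLipschitzCurve L v p γ) {t : ℝ} (ht : 0 < t) {a b : ℝ} (ha : a ∈ Icc (0 : ℝ) 1)
    (hb : b ∈ Icc (0 : ℝ) 1) (hab : a < b) :
    Real.exp (lam * (t * (b - a))) * dist (S (a * t) (γ a)) (S (b * t) (γ b)) ^ 2
      ≤ (1 + a * (Real.exp (-(2 * lam * t)) - 1)) * L ^ 2 * (b - a) ^ 2
        + 2 * expPrimitive lam (t * (b - a)) *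
          ((φ (S (a * t) (γ a))).toReal - (φ (S (b * t) (γ b))).toReal) := by
  have hat : 0 ≤ a * t := mul_nonneg ha.1 ht.le
  have hdom : S (a * t) (γ a) ∈ dom φ := by
    rcases ha.1.eq_or_lt with h | h
    · rw [← h, zero_mul, hγ.start, hS.zero v (mem_univ v)]; exact hv
    · exact hS.mem_dom (mem_univ _) (mul_pos h ht)
  have hpos : 0 < t * (b - a) := mul_pos ht (sub_pos.2 hab)
  have h1 := hS.exp_mul_sq_dist_le hbot hlsc (mem_univ (S (a * t) (γ b))) hpos hdom
  rw [← hS.semigroup _ (mem_univ _) _ _ hat hpos.le,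
    show a * t + t * (b - a) = b * t by ring] at h1
  have h2 := hS.sq_dist_contraction hbot hlsc (mem_univ (γ b)) (mem_univ (γ a)) hat
  have h3 : dist (γ b) (γ a) ^ 2 ≤ (L * (b - a)) ^ 2 := by
    rw [dist_comm]
    exact pow_le_pow_left₀ dist_nonneg (hγ.dist_le a ha b hb hab.le) 2
  have h4 : Real.exp (-(2 * lam * (a * t))) ≤ 1 + a * (Real.exp (-(2 * lam * t)) - 1) := by
    have := exp_mul_le_of_mem_Icc (-(2 * lam * t)) ha
    rwa [show a * -(2 * lam * t) = -(2 * lam * (a * t)) by ring] at this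
  have h5 : Real.exp (-(2 * lam * (a * t))) * dist (γ b) (γ a) ^ 2
      ≤ (1 + a * (Real.exp (-(2 * lam * t)) - 1)) * (L * (b - a)) ^ 2 :=
    mul_le_mul h4 h3 (sq_nonneg _) ((Real.exp_pos _).le.trans h4)
  rw [dist_comm]
  linarith

theorem IsGradientFlow.lengthDist_flow_le (hbot : ∀ x, φ x ≠ ⊥) (hlsc : LowerSemicontinuous φ)
    (hS : IsGradientFlow φ lam univ S) {v p : X} (hv : v ∈ dom φ) {L : ℝ} {γ : ℝ → X}
    (hγ : IsLipschitzCurve L v p γ) {t : ℝ} (ht : 0 < t) {η : ℝ} (hη : 0 < η) :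
    lengthDist univ v (S t p) < ∞ ∧
      (lengthDist univ v (S t p)).toReal ^ 2 ≤ (1 + η) *
        (L ^ 2 * ((1 + Real.exp (-(2 * lam * t))) / 2 + η)
          + 2 * t * ((φ v).toReal - (φ (S t p)).toReal)) := by
  set e := Real.exp (-(2 * lam * t)) with he
  set G := 1 + |e - 1| with hG
  obtain ⟨δ, hδ, hδ1, hδ2⟩ : ∃ δ : ℝ, 0 < δ ∧
      (∀ k ∈ Ioo 0 δ, |e - 1| / 2 * k + (Real.exp (|lam| * (t * k)) - 1) * G < η) ∧
      ∀ k ∈ Ioo 0 δ, Real.exp (2 * (|lam| * (t * k))) < 1 + η := by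
    have hT1 : Tendsto (fun k : ℝ => |e - 1| / 2 * k + (Real.exp (|lam| * (t * k)) - 1) * G)
        (𝓝[>] 0) (𝓝 (|e - 1| / 2 * 0 + (Real.exp (|lam| * (t * 0)) - 1) * G)) :=
      (Continuous.tendsto (by fun_prop) 0).mono_left nhdsWithin_le_nhds
    have hT2 : Tendsto (fun k : ℝ => Real.exp (2 * (|lam| * (t * k))))
        (𝓝[>] 0) (𝓝 (Real.exp (2 * (|lam| * (t * 0))))) :=
      (Continuous.tendsto (by fun_prop) 0).mono_left nhdsWithin_le_nhds
    obtain ⟨δ, hδ, hsub⟩ := mem_nhdsGT_iff_exists_Ioo_subset.1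
      ((hT1.eventually_lt_const (u := η) (by simpa using hη)).and
        (hT2.eventually_lt_const (u := 1 + η) (by simpa using hη)))
    exact ⟨δ, hδ, fun k hk => (hsub hk).1, fun k hk => (hsub hk).2⟩
  set w : ℝ → X := fun s => S (s * t) (γ s) with hw
  set Φ : ℝ → ℝ := fun s => (φ (w s)).toReal with hΦ
  -- A primitive of the chord `1 + s (e - 1)`, plus the energy term; the summand `η s` absorbs the
  -- discretization errors.
  set H : ℝ → ℝ := fun s => (1 + η) * (L ^ 2 * (s + (e - 1) * s ^ 2 / 2 + η * s) - 2 * t * Φ s)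
    with hH
  have hw0 : w 0 = v := by simp [hw, hγ.start, hS.zero v (mem_univ v)]
  have hw1 : w 1 = S t p := by simp [hw, hγ.finish]
  have hloc : ∀ a ∈ Icc (0 : ℝ) 1, ∀ b ∈ Icc (0 : ℝ) 1, a < b → b - a < δ →
      dist (w a) (w b) ^ 2 ≤ (b - a) * (H b - H a) := by
    intro a ha b hb hab hd
    have hmain := hS.sq_dist_flow_curve_le hbot hlsc hv hγ ht ha hb hab
    have hk1 := hδ1 (b - a) ⟨sub_pos.2 hab, hd⟩
    have hk2 := hδ2 (b - a) ⟨sub_pos.2 hab, hd⟩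
    have hba : b = a + (b - a) := by ring
    set k := b - a with hk
    have hk0 : 0 < k := sub_pos.2 hab
    set h := t * k with hh
    have hh0 : 0 < h := mul_pos ht hk0
    set E := expPrimitive lam h with hE
    have hE0 : 0 < E := expPrimitive_pos lam hh0
    have hEu : E ≤ h * Real.exp (|lam| * h) := expPrimitive_le lam hh0.le
    have hEl : h * Real.exp (-(|lam| * h)) ≤ E := le_expPrimitive lam hh0.le
    set P := 1 + a * (e - 1) with hP
    have hP0 : 0 ≤ P := by
      have : 0 < e := Real.exp_pos _
      have h1 : P = (1 - a) + a * e := by rw [hP]; ring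
      rw [h1]
      exact add_nonneg (sub_nonneg.2 ha.2) (mul_nonneg ha.1 this.le)
    have hPG : P ≤ G := by
      have h1 : a * (e - 1) ≤ a * |e - 1| := mul_le_mul_of_nonneg_left (le_abs_self _) ha.1
      have h2 : a * |e - 1| ≤ 1 * |e - 1| := mul_le_mul_of_nonneg_right ha.2 (abs_nonneg _)
      linarith
    set d2 := dist (w a) (w b) ^ 2 with hd2
    have hd20 : 0 ≤ d2 := sq_nonneg _
    set ΔΦ := Φ a - Φ b with hΔΦ
    change Real.exp (lam * h) * d2 ≤ P * L ^ 2 * k ^ 2 + 2 * E * ΔΦ at hmain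
    have hq : h / E ≤ Real.exp (|lam| * h) := by
      rw [div_le_iff₀ hE0]
      calc h = Real.exp (|lam| * h) * (h * Real.exp (-(|lam| * h))) := by
            rw [mul_left_comm, ← Real.exp_add, add_neg_cancel, Real.exp_zero, mul_one]
        _ ≤ _ := by gcongr
    have hq0 : 0 ≤ h / E := by positivity
    -- The factors `h / E` and `e^{λh}` tend to `1` for short steps; the constant `1 + η` covers
    -- them uniformly in the step.
    have hl : d2 ≤ (1 + η) * (h / E * (Real.exp (lam * h) * d2)) := by
      have h1 : 1 ≤ (1 + η) * (h / E * Real.exp (lam * h)) := by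
        rw [div_mul_eq_mul_div, mul_div_assoc', le_div_iff₀ hE0, one_mul]
        have h2 : Real.exp (|lam| * h) ≤ Real.exp (2 * (|lam| * h)) * Real.exp (lam * h) := by
          rw [← Real.exp_add]
          apply Real.exp_le_exp.2
          have := mul_le_mul_of_nonneg_right (neg_le_abs lam) hh0.le
          linarith
        calc E ≤ h * Real.exp (|lam| * h) := hEu
          _ ≤ h * (Real.exp (2 * (|lam| * h)) * Real.exp (lam * h)) := by gcongr
          _ ≤ h * ((1 + η) * Real.exp (lam * h)) := by gcongr
          _ = _ := by ring
      calc d2 = 1 * d2 := (one_mul _).symm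
        _ ≤ (1 + η) * (h / E * Real.exp (lam * h)) * d2 := by gcongr
        _ = _ := by ring
    -- Scaling by `h / E` makes the energy coefficient exactly `2tk`. The difference `ΔΦ` has no
    -- known sign, so it could not be estimated and must telescope.
    have hr : h / E * (Real.exp (lam * h) * d2) ≤
        k * (L ^ 2 * (h / E * P * k) + 2 * t * ΔΦ) := by
      calc _ ≤ h / E * (P * L ^ 2 * k ^ 2 + 2 * E * ΔΦ) := by gcongr
        _ = k * (L ^ 2 * (h / E * P * k)) + 2 * h * ΔΦ := by field_simp
        _ = _ := by rw [hh]; ring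
    have hPk : h / E * P * k ≤
        (b + (e - 1) * b ^ 2 / 2 + η * b) - (a + (e - 1) * a ^ 2 / 2 + η * a) := by
      have h1 : h / E * P ≤ P + (Real.exp (|lam| * h) - 1) * G := by
        have h2 : h / E * P ≤ Real.exp (|lam| * h) * P := by gcongr
        have h3 : 0 ≤ Real.exp (|lam| * h) - 1 :=
          sub_nonneg.2 (Real.one_le_exp (by positivity))
        have h4 := mul_le_mul_of_nonneg_left hPG h3
        linarith
      have h5 : h / E * P ≤ P + η - |e - 1| / 2 * k := by linarith
      have h6 := mul_le_mul_of_nonneg_right h5 hk0.le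
      have h7 : -(|e - 1| / 2 * k * k) ≤ (e - 1) / 2 * k * k := by
        have := mul_le_mul_of_nonneg_right (neg_abs_le (e - 1))
          (by positivity : 0 ≤ k * k / 2)
        linarith
      rw [hP] at h6
      rw [hba]
      linarith
    calc d2 ≤ _ := hl
      _ ≤ (1 + η) * (k * (L ^ 2 * (h / E * P * k) + 2 * t * ΔΦ)) := by gcongr
      _ ≤ (1 + η) * (k * (L ^ 2 * ((b + (e - 1) * b ^ 2 / 2 + η * b) -
          (a + (e - 1) * a ^ 2 / 2 + η * a)) + 2 * t * ΔΦ)) := by gcongr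
      _ = k * (H b - H a) := by simp only [hH, hΔΦ]; ring
  have hfin := lengthDist_le_of_sq_dist_le_mul hδ hloc
  rw [hw0, hw1] at hfin
  refine ⟨hfin.1, hfin.2.trans (le_of_eq ?_)⟩
  simp only [hH, hΦ, hw0, hw1]
  ring

/-- Both the slack `η` and the excess of the curve's Lipschitz constant over the length distance
tend to `0`. -/
theorem IsGradientFlow.sq_lengthDist_le (hbot : ∀ x, φ x ≠ ⊥) (hlsc : LowerSemicontinuous φ)
    (hS : IsGradientFlow φ lam univ S) {v p : X} (hv : v ∈ dom φ)
    (hvp : lengthDist univ v p < ∞) {t : ℝ} (ht : 0 < t) :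
    lengthDist univ v (S t p) < ∞ ∧
      (lengthDist univ v (S t p)).toReal ^ 2 ≤
        (1 + Real.exp (-(2 * lam * t))) / 2 * (lengthDist univ v p).toReal ^ 2
          + 2 * t * ((φ v).toReal - (φ (S t p)).toReal) := by
  constructor
  · obtain ⟨L, γ, hγ⟩ := exists_isLipschitzCurve_of_lt_top hvp
    exact (hS.lengthDist_flow_le hbot hlsc hv hγ ht one_pos).1
  set d := (lengthDist univ v p).toReal with hd
  set A := (1 + Real.exp (-(2 * lam * t))) / 2 with hA
  have hA0 : 0 ≤ A := by positivity
  set F := 2 * t * ((φ v).toReal - (φ (S t p)).toReal) with hF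
  have hT : Tendsto (fun η : ℝ => (1 + η) * ((d + η) ^ 2 * (A + η) + F)) (𝓝[>] 0)
      (𝓝 ((1 + 0) * ((d + 0) ^ 2 * (A + 0) + F))) :=
    (Continuous.tendsto (by fun_prop) 0).mono_left nhdsWithin_le_nhds
  have hle := ge_of_tendsto (b := (lengthDist univ v (S t p)).toReal ^ 2) hT (by
    filter_upwards [self_mem_nhdsWithin] with η hη
    have hη0 : 0 < η := hη
    obtain ⟨L, hL, γ, hγ⟩ := exists_isLipschitzCurve_of_toReal_lt hvp
      (lt_add_of_pos_right d hη0)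
    have hL0 := hγ.nonneg
    refine (hS.lengthDist_flow_le hbot hlsc hv hγ ht hη0).2.trans ?_
    gcongr)
  linarith

theorem IsGradientFlow.approxConvexIn_lengthClass (hbot : ∀ x, φ x ≠ ⊥)
    (hlsc : LowerSemicontinuous φ) (hS : IsGradientFlow φ lam univ S) (a : X) :
    ApproxConvexIn (fun x y => (lengthDist univ x y).toReal) φ lam (lengthClass univ a) := by
  refine approxConvexIn_of_regularizing (S := S)
    (A := fun t => (1 + Real.exp (-(2 * lam * t))) / 2) (B := fun t => t) hbot
    (fun x hx y hy => dist_le_toReal_lengthDist (lengthDist_lt_top_of_mem_lengthClass hx hy))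
    (fun x _ => by simp [lengthDist_self])
    (fun x hx y hy z hz => toReal_lengthDist_triangle
      (lengthDist_lt_top_of_mem_lengthClass hx hy) (lengthDist_lt_top_of_mem_lengthClass hy hz))
    (fun x _ y _ => by rw [lengthDist_comm])
    (fun x _ => hS.exists_quadratic_lower_bound hbot hlsc (mem_univ x))
    ?_ (fun t _ => by positivity) (fun t ht => ht) nhdsWithin_le_nhds ?_
    (fun x₀ hx₀ x₁ hx₁ hpos θ hθ ε hε =>
      exists_isIntermediatePoint_lengthDist hx₀ hx₁ hpos hθ hε.1)
  · rintro v ⟨hv, hvφ⟩ p hp t ht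
    obtain ⟨h1, h2⟩ := hS.sq_lengthDist_le hbot hlsc hvφ
      (lengthDist_lt_top_of_mem_lengthClass hv hp) ht
    rw [lengthDist_comm] at h1
    exact ⟨⟨⟨mem_univ _, lengthDist_lt_top_trans h1 hv.2⟩, hS.mem_dom (mem_univ p) ht⟩, h2⟩
  · have hder : HasDerivAt (fun t : ℝ => Real.exp (-(2 * lam * t))) (-(2 * lam)) 0 := by
      simpa using (((hasDerivAt_id (0 : ℝ)).const_mul (2 * lam)).neg).exp
    have h1 := ((hasDerivAt_iff_tendsto_slope_zero.1 hder).mono_left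
      (nhdsGT_le_nhdsNE 0)).const_mul (-(1 / 2))
    rw [show -(1 / 2) * -(2 * lam) = lam by ring] at h1
    refine h1.congr fun t => ?_
    simp only [zero_add, mul_zero, neg_zero, Real.exp_zero, smul_eq_mul, div_eq_mul_inv]
    ring

end EVI

/-! ### Assembly of the theorem -/

theorem theorem3p9 {X : Type*} [MetricSpace X] (φ : X → EReal)
    (hbot : ∀ x, φ x ≠ ⊥) (hproper : (EVI.dom φ).Nonempty) (hlsc : LowerSemicontinuous φ)
    (lam : ℝ) (D : Set X) (S : ℝ → X → X) (hS : EVI.IsGradientFlow φ lam D S) :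
    (∀ x₀ ∈ D ∩ EVI.dom φ, ∀ x₁ ∈ D ∩ EVI.dom φ,
      ∀ θ ∈ Set.Ioo (0 : ℝ) 1, ∀ ε ∈ Set.Ioo (0 : ℝ) 1,
      ∀ x ∈ D, EVI.IsIntermediatePoint dist θ ε x₀ x₁ x → ∀ t : ℝ, 0 < t →
        φ (S t x) ≤ ((1 - θ : ℝ) : EReal) * φ x₀ + (θ : EReal) * φ x₁
          - ((1 / 2 * (lam - ε ^ 2 / EVI.expPrimitive lam t) * θ * (1 - θ)
              * dist x₀ x₁ ^ 2 : ℝ) : EReal)) ∧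
    (EVI.IsApproxLength D → EVI.ApproxConvexIn dist φ lam D) ∧
    (D = Set.univ → EVI.lengthClosure (EVI.dom φ) = Set.univ →
      ∀ a : X, EVI.ApproxConvexIn (fun x y => (EVI.lengthDist Set.univ x y).toReal) φ lam
        (EVI.lengthClass Set.univ a)) ∧
    (∀ x₀ ∈ D ∩ EVI.dom φ, ∀ x₁ ∈ D ∩ EVI.dom φ, ∀ γ : ℝ → X,
      EVI.IsGeodesicIn D x₀ x₁ γ → EVI.ConvexAlong φ lam γ) ∧
    ((∀ x₀ ∈ D ∩ EVI.dom φ, ∀ x₁ ∈ D ∩ EVI.dom φ, ∃ γ : ℝ → X, EVI.IsGeodesicIn D x₀ x₁ γ) →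
      EVI.StronglyConvexIn φ lam D) := by
  have hconv : ∀ x₀ ∈ D ∩ EVI.dom φ, ∀ x₁ ∈ D ∩ EVI.dom φ, ∀ γ : ℝ → X,
      EVI.IsGeodesicIn D x₀ x₁ γ → EVI.ConvexAlong φ lam γ :=
    fun x₀ h₀ x₁ h₁ γ hγ => hS.convexAlong hbot hlsc h₀.2 h₁.2 hγ
  refine ⟨?_, hS.approxConvexIn hbot hlsc, ?_, hconv, fun hgeo => ⟨?_, hconv⟩⟩
  · intro x₀ h₀ x₁ h₁ θ hθ ε _ x hx hmid t ht
    rw [EVI.le_convex_combination_iff hbot h₀.2 h₁.2 (hS.mem_dom hx ht)]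
    exact hS.le_at_intermediatePoint hbot hlsc h₀.2 h₁.2 hθ hx hmid ht
  · intro hD _ a
    subst hD
    exact hS.approxConvexIn_lengthClass hbot hlsc a
  · intro x₀ h₀ x₁ h₁
    obtain ⟨γ, hγ⟩ := hgeo x₀ h₀ x₁ h₁
    exact ⟨γ, hγ, hconv x₀ h₀ x₁ h₁ γ hγ⟩
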